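/- Let $S^2\subset\mathbb R^3$ be the unit sphere with round metric $\sigma_{AB}$, Levi-Civita connection $\nabla$, Laplacian $\Delta$ and area form $\epsilon_{AB}$. Let $\tilde X^1,\tilde X^2,\tilde X^3$ be the restrictions to $S^2$ of the coordinates of $\mathbb R^3$, and put $Y^A=\epsilon^{AB}\nabla_B\tilde X^k$. All integrals are with respect to the area measure of $S^2$, and indices are raised and lowered with $\sigma$. **Null infinity data.** Let $I\subset\mathbb R$ be an interval. Null infinity data of a vacuum spacetime on $I\times S^2$ in a Bondi–Sachs coordinate system $(u,x)$ consist of a mass aspect $m(u,x)$, an angular momentum aspect $N_A(u,x)$ (a one-form on $S^2$) and a shear $C_{AB}(u,x)$ (a symmetric traceless 2-tensor on $S^2$), all smooth in $(u,x)$, which satisfy, with the news $N_{AB}=\partial_uC_{AB}$, the evolution equations induced by the vacuum Einstein equation: $$\partial_u m=-\tfrac18N_{AB}N^{AB}+\tfrac14\nabla^A\nabla^BN_{AB},$$ $$\partial_uN_A=\nabla_Am-\tfrac14\nabla^BP_{BA}+\tfrac14\nabla_A(C_{BE}N^{BE})-\tfrac14\nabla_B(C^{BD}N_{DA})+\tfrac12C_{AB}\nabla_DN^{DB},$$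 where $P_{BA}=\nabla_B\nabla^EC_{EA}-\nabla_A\nabla^EC_{EB}$. **Potentials.** Smooth functions $c,\underline c$ on $S^2$ are the potentials of a symmetric traceless tensor $C_{AB}$ if both are $L^2$-orthogonal to $1,\tilde X^1,\tilde X^2,\tilde X^3$ and $$C_{AB}=\nabla_A\nabla_Bc-\tfrac12\sigma_{AB}\Delta c+\underline F_{AB},\qquad \underline F_{AB}=\tfrac12\left(\epsilon_A{}^E\nabla_E\nabla_B\underline c+\epsilon_B{}^E\nabla_E\nabla_A\underline c\right).$$ **Chen–Wang–Yau (CWY) angular momentum and center of mass.** For $k=1,2,3$, with $c,\underline c$ the potentials of $C_{AB}(u,\cdot)$, $$J^k(u)=\int_{S^2}\epsilon^{AB}\nabla_B\tilde X^k\left(N_A-\tfrac14C_{AB}\nabla_DC^{DB}-c\nabla_Am\right),$$ $$C^k(u)=\int_{S^2}\nabla^A\tilde X^k\Big[N_A-u\nabla_Am-\tfrac14C_{AB}\nabla_DC^{DB}-\tfrac1{16}\nabla_A(C^{DE}C_{DE})-c\nabla_Am+2\epsilon_{AB}(\nabla^B\underline c)m\Big]+\int_{S^2}\Big(3\tilde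 X^kcm-\tfrac14\tilde X^k\nabla_A\underline F^{AB}\nabla^D\underline F_{DB}\Big).$$ **Supertranslation.** For $f\in C^\infty(S^2)$, the supertranslation $u=\bar u+f(x)$ produces the fields in the coordinates $(\bar u,x)$ given by $$\bar m=m+\tfrac12\nabla^BN_{BD}\nabla^Df+\tfrac14\partial_uN_{BD}\nabla^Bf\nabla^Df+\tfrac14N_{BD}\nabla^B\nabla^Df,$$ $$\bar C_{AB}=C_{AB}-2\nabla_A\nabla_Bf+\Delta f\,\sigma_{AB},$$ and, when the news vanishes, $$\bar N_A=N_A+3m\nabla_Af-\tfrac34P_{BA}\nabla^Bf.$$ Here the left sides are evaluated at $(\bar u,x)$ and the fields and their derivatives on the right sides at $(\bar u+f(x),x)$. Let $\bar J^k(\bar u)$ and $\bar C^k(\bar u)$ be defined by the formulas above from the barred fields, the potentials of $\bar C_{AB}(\bar u,\cdot)$, and $\bar u$ in place of $u$. Write $$f_{\ell\le1}=\frac1{4\pi}\int_{S^2}f+\sum_{i=1}^3\Big(\frac3{4\pi}\int_{S^2}f\tilde X^i\Big)\tilde X^i.$$ **Theorem.** Let null infinity data on $I\times S^2$ with $N_{AB}\equiv0$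 be given, and suppose that $c(u,\cdot),\underline c(u,\cdot)$ are the potentials of $C_{AB}(u,\cdot)$ for each $u\in I$. Then: 1. $J^k(u)$ and $C^k(u)$, $k=1,2,3$, are independent of $u\in I$. 2. Let $f\in C^\infty(S^2)$ and let $\bar u_0\in\mathbb R$ satisfy $\bar u_0+f(x)\in I$ for all $x\in S^2$. Let $\bar c,\bar{\underline c}$ be the potentials of $\bar C_{AB}(\bar u_0,\cdot)$. Then for all $u_0\in I$ and $k=1,2,3$, with $\mathring m=m(u_0,\cdot)$, $$\bar J^k(\bar u_0)-J^k(u_0)=-2\int_{S^2}Y^Af_{\ell\le1}\nabla_A\mathring m,$$ $$\bar C^k(\bar u_0)-C^k(u_0)=\int_{S^2}\left(6f_{\ell\le1}\tilde X^k\mathring m-2f_{\ell\le1}\nabla^A\tilde X^k\nabla_A\mathring m\right).$$ -/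

import Mathlib

open MeasureTheory
open scoped Manifold ContDiff

noncomputable section

namespace NullInfinity

/-! ### Tensor calculus on the round unit sphere

Tensors on `S²` are written in Cartesian components of `ℝ³`: a one-form is a field
`w : S² → Fin 3 → ℝ` with `∑ a, x a * w x a = 0`, and similarly for 2-tensors.  In this description
the contraction with the round metric is the sum over repeated Cartesian indices, and the
Levi-Civita connection is the tangential projection of the ambient derivative. -/

/-- The standard unit 2-sphere in `ℝ³`. -/
abbrev S2 : Type := Metric.sphere (0 : EuclideanSpace ℝ (Fin 3)) 1

/-- The area measure of the round unit sphere (total mass `4π`). -/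
def area : Measure S2 := (volume : Measure (EuclideanSpace ℝ (Fin 3))).toSphere

/-- The restriction of the `k`-th Cartesian coordinate of `ℝ³` to the sphere. -/
def coord (k : Fin 3) (x : S2) : ℝ := (x : EuclideanSpace ℝ (Fin 3)) k

/-- Smooth functions on the sphere (Mathlib's manifold structure). -/
def SmoothFn (f : S2 → ℝ) : Prop := ContMDiff (𝓡 2) 𝓘(ℝ, ℝ) ∞ f

theorem normalize_mem {y : EuclideanSpace ℝ (Fin 3)} (hy : y ≠ 0) :
    ‖y‖⁻¹ • y ∈ Metric.sphere (0 : EuclideanSpace ℝ (Fin 3)) 1 := by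
  simp [norm_smul, hy]

open Classical in
/-- The extension `y ↦ f (y / |y|)` of a function on the sphere, constant along rays. -/
def radialExt (f : S2 → ℝ) (y : EuclideanSpace ℝ (Fin 3)) : ℝ :=
  if hy : y ≠ 0 then f ⟨‖y‖⁻¹ • y, normalize_mem hy⟩ else 0

/-- `∇_a f`: the Cartesian components of the differential of `f`. Since the radial extension is
constant along rays, its ambient gradient at a point of the sphere is tangential. -/
def grad (f : S2 → ℝ) (x : S2) (a : Fin 3) : ℝ :=
  fderiv ℝ (radialExt f) (x : EuclideanSpace ℝ (Fin 3)) (EuclideanSpace.single a 1)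

/-- The round metric `σ_{ab}`, equivalently the tangential projection `δ_{ab} - x_a x_b`. -/
def metric (x : S2) (a b : Fin 3) : ℝ := (if a = b then 1 else 0) - coord a x * coord b x

/-- The area form `ε_{ab}`, with `ε(v, w) = det (x, v, w)`. -/
def eps (x : S2) (a b : Fin 3) : ℝ :=
  (!![0, coord 2 x, -coord 1 x; -coord 2 x, 0, coord 0 x; coord 1 x, -coord 0 x, 0] :
    Matrix (Fin 3) (Fin 3) ℝ) a b

/-- `∇_a w_b` for a one-form `w`. -/
def covDeriv₁ (w : S2 → Fin 3 → ℝ) (x : S2) (a b : Fin 3) : ℝ :=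
  ∑ d, metric x b d * grad (fun y => w y d) x a

/-- `∇_a T_{bc}` for a 2-tensor `T`. -/
def covDeriv₂ (T : S2 → Fin 3 → Fin 3 → ℝ) (x : S2) (a b c : Fin 3) : ℝ :=
  ∑ d, ∑ e, metric x b d * metric x c e * grad (fun y => T y d e) x a

/-- `∇^A w_A`. -/
def div₁ (w : S2 → Fin 3 → ℝ) (x : S2) : ℝ := ∑ a, covDeriv₁ w x a a

/-- `∇^A T_{AB}`. -/
def div₂ (T : S2 → Fin 3 → Fin 3 → ℝ) (x : S2) (b : Fin 3) : ℝ := ∑ a, covDeriv₂ T x a a b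

/-- `∇_A ∇_B f`. -/
def hess (f : S2 → ℝ) : S2 → Fin 3 → Fin 3 → ℝ := covDeriv₁ (grad f)

/-- The Laplacian `Δ f = ∇^A ∇_A f`. -/
def lap (f : S2 → ℝ) : S2 → ℝ := div₁ (grad f)

/-- The pointwise inner product `S_{AB} T^{AB}`. -/
def inner₂ (S T : S2 → Fin 3 → Fin 3 → ℝ) (x : S2) : ℝ := ∑ a, ∑ b, S x a b * T x a b

/-- The rotation field `Y^A = ε^{AB} ∇_B X^k`. -/
def rot (k : Fin 3) (x : S2) (a : Fin 3) : ℝ := ∑ b, eps x a b * grad (coord k) x b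

/-- The function has no `ℓ = 0` and no `ℓ = 1` part: it is `L²`-orthogonal to `1, X¹, X², X³`. -/
def SupportedInHighModes (c : S2 → ℝ) : Prop :=
  (∫ x, c x ∂area) = 0 ∧ ∀ i, (∫ x, c x * coord i x ∂area) = 0

/-- `f_{ℓ ≤ 1}`: the `L²`-projection `α₀ + α_i X^i` of `f` to the modes `ℓ = 0, 1`
(recall `∫ 1 = 4π` and `∫ X^i X^j = (4π/3) δ^{ij}`). -/
def lowModes (f : S2 → ℝ) (x : S2) : ℝ :=
  (4 * Real.pi)⁻¹ * (∫ y, f y ∂area) +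
    ∑ i, (3 / (4 * Real.pi) * ∫ y, f y * coord i y ∂area) * coord i x

/-! ### Shear potentials -/

/-- The co-closed tensor
`F̲_{AB} = ½ (ε_A{}^E ∇_E ∇_B c̲ + ε_B{}^E ∇_E ∇_A c̲)` with potential `c̲`. -/
def coclosedPart (cb : S2 → ℝ) (x : S2) (a b : Fin 3) : ℝ :=
  (1 / 2) * ∑ e, (eps x a e * hess cb x e b + eps x b e * hess cb x e a)

/-- `c, c̲` are the potentials (supported in the modes `ℓ ≥ 2`) of the symmetric traceless
tensor `C`. -/
structure IsPotentials (C : S2 → Fin 3 → Fin 3 → ℝ) (c cb : S2 → ℝ) : Prop where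
  smooth_c : SmoothFn c
  smooth_cb : SmoothFn cb
  high_c : SupportedInHighModes c
  high_cb : SupportedInHighModes cb
  decomposition : ∀ x a b,
    C x a b = hess c x a b - (1 / 2) * metric x a b * lap c x + coclosedPart cb x a b

/-! ### Null infinity data -/

/-- The fields on null infinity in a Bondi-Sachs coordinate system `(u, x)`: the mass aspect
`m(u, x)`, the angular momentum aspect `N_A(u, x)` and the shear `C_{AB}(u, x)`. -/
structure Fields where
  m : ℝ → S2 → ℝ
  N : ℝ → S2 → Fin 3 → ℝ
  C : ℝ → S2 → Fin 3 → Fin 3 → ℝ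

/-- The news tensor `N_{AB} = ∂_u C_{AB}` on the interval `I` of retarded times. -/
def Fields.news (D : Fields) (I : Set ℝ) (u : ℝ) (x : S2) (a b : Fin 3) : ℝ :=
  derivWithin (fun s => D.C s x a b) I u

/-- The curl of the divergence of the shear,
`P_{BA} = ∇_B ∇^E C_{EA} - ∇_A ∇^E C_{EB}`. -/
def curlDiv (C : S2 → Fin 3 → Fin 3 → ℝ) (x : S2) (b a : Fin 3) : ℝ :=
  covDeriv₁ (div₂ C) x b a - covDeriv₁ (div₂ C) x a b

/-- A real function on `I × S²` which is smooth in `(u, x)`. -/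
def SmoothOn (I : Set ℝ) (F : ℝ → S2 → ℝ) : Prop :=
  ContMDiffOn (𝓘(ℝ, ℝ).prod (𝓡 2)) 𝓘(ℝ, ℝ) ∞ (fun p : ℝ × S2 => F p.1 p.2) (I ×ˢ Set.univ)

/-- Null infinity data on `I × S²` of an asymptotically flat vacuum spacetime: smooth fields
`m, N_A, C_{AB}`, with `N_A` a one-form and `C_{AB}` a symmetric traceless 2-tensor on the sphere,
obeying the evolution equations that the vacuum Einstein equation induces on null infinity. -/
structure Fields.IsNullInfinityData (D : Fields) (I : Set ℝ) : Prop where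
  smooth_m : SmoothOn I D.m
  smooth_N : ∀ a, SmoothOn I (fun u x => D.N u x a)
  smooth_C : ∀ a b, SmoothOn I (fun u x => D.C u x a b)
  tangent_N : ∀ u ∈ I, ∀ x, ∑ a, coord a x * D.N u x a = 0
  tangent_C : ∀ u ∈ I, ∀ x b, ∑ a, coord a x * D.C u x a b = 0
  symm_C : ∀ u ∈ I, ∀ x a b, D.C u x a b = D.C u x b a
  traceless_C : ∀ u ∈ I, ∀ x, ∑ a, D.C u x a a = 0
  /-- `∂_u m = -⅛ N_{AB} N^{AB} + ¼ ∇^A ∇^B N_{AB}` -/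
  evolution_m : ∀ u ∈ I, ∀ x,
    derivWithin (fun s => D.m s x) I u =
      -(1 / 8) * inner₂ (D.news I u) (D.news I u) x + (1 / 4) * div₁ (div₂ (D.news I u)) x
  /-- `∂_u N_A = ∇_A m - ¼ ∇^B (∇_B ∇^E C_{EA} - ∇_A ∇^E C_{EB}) + ¼ ∇_A (C_{BE} N^{BE})
  - ¼ ∇_B (C^{BD} N_{DA}) + ½ C_{AB} ∇_D N^{DB}` -/
  evolution_N : ∀ u ∈ I, ∀ x a,
    derivWithin (fun s => D.N s x a) I u =
      grad (D.m u) x a - (1 / 4) * div₂ (curlDiv (D.C u)) x a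
        + (1 / 4) * grad (inner₂ (D.C u) (D.news I u)) x a
        - (1 / 4) * div₂ (fun y b e => ∑ d, D.C u y b d * D.news I u y d e) x a
        + (1 / 2) * ∑ b, D.C u x a b * div₂ (D.news I u) x b

/-- The news vanishes identically on `I × S²`. -/
def Fields.VanishingNews (D : Fields) (I : Set ℝ) : Prop :=
  ∀ u ∈ I, ∀ x a b, D.news I u x a b = 0

/-- The fields in the Bondi-Sachs coordinate system `(ū, x)` related to `(u, x)` by the
supertranslation `u = ū + f(x)`:
* `m̄(ū, x) = m + ½ ∇^B N_{BD} ∇^D f + ¼ ∂_u N_{BD} ∇^B f ∇^D f + ¼ N_{BD} ∇^B ∇^D f`,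
* `N̄_A(ū, x) = N_A + 3 m ∇_A f - ¾ P_{BA} ∇^B f`, which is the transformation law of the angular
  momentum aspect for vanishing news (the only case in which it is used),
* `C̄_{AB}(ū, x) = C_{AB} - 2 ∇_A ∇_B f + Δf σ_{AB}`,

where the (derivatives of the) original fields on the right are evaluated at `(ū + f(x), x)`. -/
def Fields.supertranslate (D : Fields) (I : Set ℝ) (f : S2 → ℝ) : Fields where
  m := fun ub x =>
    D.m (ub + f x) x
      + (1 / 2) * ∑ d, div₂ (D.news I (ub + f x)) x d * grad f x d
      + (1 / 4) * ∑ b, ∑ d,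
          derivWithin (fun s => D.news I s x b d) I (ub + f x) * grad f x b * grad f x d
      + (1 / 4) * inner₂ (D.news I (ub + f x)) (hess f) x
  N := fun ub x a =>
    D.N (ub + f x) x a + 3 * D.m (ub + f x) x * grad f x a
      - (3 / 4) * ∑ b, curlDiv (D.C (ub + f x)) x b a * grad f x b
  C := fun ub x a b =>
    D.C (ub + f x) x a b - 2 * hess f x a b + lap f x * metric x a b

/-! ### The Chen-Wang-Yau angular momentum and center of mass -/

/-- The CWY angular momentum at retarded time `u`,
`J^k = ∫ ε^{AB} ∇_B X^k (N_A - ¼ C_{AB} ∇_D C^{DB} - c ∇_A m)`,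
where `c` is the closed potential of `C_{AB}(u, ·)`. -/
def Fields.angularMomentum (D : Fields) (u : ℝ) (c : S2 → ℝ) (k : Fin 3) : ℝ :=
  ∫ x, ∑ a, rot k x a *
    (D.N u x a - (1 / 4) * ∑ b, D.C u x a b * div₂ (D.C u) x b - c x * grad (D.m u) x a) ∂area

/-- The CWY center of mass at retarded time `u`,
`C^k = ∫ ∇^A X^k [N_A - u ∇_A m - ¼ C_{AB} ∇_D C^{DB} - (1/16) ∇_A (C^{DE} C_{DE}) - c ∇_A m
  + 2 ε_{AB} (∇^B c̲) m] + ∫ (3 X^k c m - ¼ X^k ∇_A F̲^{AB} ∇^D F̲_{DB})`,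
where `c, c̲` are the potentials of `C_{AB}(u, ·)` and `F̲` is its co-closed part. -/
def Fields.centerOfMass (D : Fields) (u : ℝ) (c cb : S2 → ℝ) (k : Fin 3) : ℝ :=
  (∫ x, ∑ a, grad (coord k) x a *
    (D.N u x a - u * grad (D.m u) x a - (1 / 4) * ∑ b, D.C u x a b * div₂ (D.C u) x b
      - (1 / 16) * grad (inner₂ (D.C u) (D.C u)) x a - c x * grad (D.m u) x a
      + 2 * (∑ b, eps x a b * grad cb x b) * D.m u x) ∂area)
  + ∫ x, (3 * coord k x * c x * D.m u x
      - (1 / 4) * coord k x *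
        ∑ b, div₂ (coclosedPart cb) x b * div₂ (coclosedPart cb) x b) ∂area

end NullInfinity

end

noncomputable section

namespace NullInfinity

/-! With zero news, `m` and `C` do not depend on `u`, and `∂_u N_A = ∇_A m - ¼ ∇^B P_{BA}` is
constant in `u`, so `N` is affine in `u`. Conservation and the supertranslation law then become one
comparison of fields on a single sphere: `N` changes by `aspectShift`, `C` by `H = -2∇∇f + Δf σ`
(`shearShift`), and the charges before and after are compared. Taking `f = 0` gives conservation.

The potentials change by `c ↦ c - 2(f - f_{ℓ≤1})` while `c̲` stays fixed (`potentials_shift`). This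
is uniqueness of potentials in the modes `ℓ ≥ 2`: the divergence of the tensor built from `(c, c̲)`
is `½(∇p + ε∇q)` with `p = (Δ+2)c`, `q = (Δ+2)c̲`, the two summands are `L²`-orthogonal, and the
kernel of `Δ+2` consists of the first harmonics.

Mass terms: `f∇m + 3m∇f = 3∇(fm) - 2f∇m`, and the new potential contributes `2(f - f_{ℓ≤1})∇m`, so
`f∇m` survives only through its low modes. The gradient `3∇(fm)` pairs to zero with a rotation
field; against `∇X^k` it gives `6∫X^k f m`, which the term `3X^k c m` reduces to low modes.

Shear terms: they are collected in `shearDensity`. Its integral against a rotation vanishes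
(`int_rotation_mul_shearDensity`), and against `∇X^k` it is balanced by the change of `∫X^k|C|²`
(`int_conformal_mul_shearDensity`).

All of this is carried out in an abstract algebra with derivations `D a`, the Cartesian components
of the tangential gradient, so that tensor identities become ring identities. The instance `sphere`
verifies the axioms for the actual sphere. -/

/-- The tangential differential calculus of the unit sphere in Cartesian components: the
coordinates `x a`, the components `D a` of the tangential gradient and the integral, acting on an
algebra of smooth functions. -/
structure TangentialCalculus (A : Type*) [CommRing A] [Algebra ℝ A] where
  x : Fin 3 → A
  D : Fin 3 → Derivation ℝ A A
  int : A →ₗ[ℝ] ℝ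
  sum_x_mul_x : ∑ a, x a * x a = 1
  D_x : ∀ a b, D a (x b) = (if a = b then 1 else 0) - x a * x b
  sum_x_mul_D : ∀ f, ∑ a, x a * D a f = 0
  D_comm : ∀ a b f, D a (D b f) = D b (D a f) + x a * D b f - x b * D a f
  int_D : ∀ a f, int (D a f) = 2 * int (x a * f)
  int_one : int 1 = 4 * Real.pi
  int_mul_self_nonneg : ∀ f, 0 ≤ int (f * f)
  eq_zero_of_int_mul_self : ∀ f, int (f * f) = 0 → f = 0
  eq_const_of_D_eq_zero : ∀ f, (∀ a, D a f = 0) → ∃ r : ℝ, f = algebraMap ℝ A r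

/-! ### Tensor identities: Hessians, divergences and the divergence theorem -/

namespace TangentialCalculus

variable {A : Type*} [CommRing A] [Algebra ℝ A] (S : TangentialCalculus A)

/-- The Laplacian. -/
def lap (f : A) : A := ∑ a, S.D a (S.D a f)

/-- The covariant Hessian in Cartesian components. -/
def hess (f : A) (a b : Fin 3) : A := S.D a (S.D b f) + S.x b * S.D a f

/-- The tangential projection. -/
def met (a b : Fin 3) : A := (if a = b then 1 else 0) - S.x a * S.x b

/-- The area form. -/
def eps (a b : Fin 3) : A :=
  (!![0, S.x 2, -S.x 1; -S.x 2, 0, S.x 0; S.x 1, -S.x 0, 0] : Matrix (Fin 3) (Fin 3) A) a b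

/-- The divergence of a tangential 2-tensor with vanishing trace. -/
def dvg (T : Fin 3 → Fin 3 → A) (b : Fin 3) : A := ∑ a, S.D a (T a b)

/-- The antisymmetrized covariant derivative of a tangential one-form. -/
def curl (t : Fin 3 → A) (b a : Fin 3) : A :=
  (S.D b (t a) + S.x a * t b) - (S.D a (t b) + S.x b * t a)

/-- Symmetric, traceless and tangential 2-tensors. -/
structure IsSTT (T : Fin 3 → Fin 3 → A) : Prop where
  symm : ∀ a b, T a b = T b a
  tangent : ∀ b, ∑ a, S.x a * T a b = 0
  traceless : ∑ a, T a a = 0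

theorem sum_x_mul_D_D (f : A) (b : Fin 3) : ∑ a, S.x a * S.D b (S.D a f) = - S.D b f := by
  have h := congrArg (S.D b) (S.sum_x_mul_D f)
  have h0 := S.sum_x_mul_D f
  simp only [Fin.sum_univ_three, map_add, Derivation.leibniz, smul_eq_mul, S.D_x, map_zero]
    at h h0 ⊢
  fin_cases b <;> simp at h ⊢
  · linear_combination h + S.x 0 * h0
  · linear_combination h + S.x 1 * h0
  · linear_combination h + S.x 2 * h0

/-- The axiom `int_D` leaves only the mean curvature term `2∫ x·w`, which vanishes for tangential
`w`. -/
theorem int_div {w : Fin 3 → A} (hw : ∑ a, S.x a * w a = 0) : S.int (∑ a, S.D a (w a)) = 0 := by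
  rw [map_sum]
  simp only [S.int_D]
  rw [← Finset.mul_sum, ← map_sum, hw, map_zero, mul_zero]

theorem int_eq_zero_of_eq_div {g : A} (w : Fin 3 → A) (hw : ∑ a, S.x a * w a = 0)
    (h : g = ∑ a, S.D a (w a)) : S.int g = 0 := h ▸ S.int_div hw

/-- The form in which integrations by parts are done below: exhibit a tangential field whose
divergence is the difference of the integrands, then check a ring identity. -/
theorem int_eq_of_sub_eq_div {g g' : A} (w : Fin 3 → A) (hw : ∑ a, S.x a * w a = 0)
    (h : g - g' = ∑ a, S.D a (w a)) : S.int g = S.int g' := by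
  rw [← sub_eq_zero, ← map_sub]
  exact S.int_eq_zero_of_eq_div w hw h

theorem int_sum_mul_D {w : Fin 3 → A} (hw : ∑ a, S.x a * w a = 0) (v : A) :
    S.int (∑ a, w a * S.D a v) = - S.int (v * ∑ a, S.D a (w a)) := by
  rw [← map_neg]
  refine S.int_eq_of_sub_eq_div (fun a => v * w a) ?_ ?_
  · simp only [Fin.sum_univ_three] at *
    linear_combination v * hw
  · simp only [Fin.sum_univ_three, Derivation.leibniz, smul_eq_mul]
    ring

/-- Commuting derivatives produces the Ricci term `D b f` (the unit sphere has Ricci tensor equal to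
the metric). The term `- x b * lap f` is normal: the ambient divergence of a tangential tensor has
normal component minus its trace. -/
theorem sum_D_hess (f : A) (b : Fin 3) :
    S.dvg (S.hess f) b = S.D b (S.lap f) + S.D b f - S.x b * S.lap f := by
  have h0 := S.sum_x_mul_D f
  have h1 := S.sum_x_mul_x
  have h2 := S.sum_x_mul_D_D f b
  have h3 := fun b => S.sum_x_mul_D (S.D b f)
  have hc : ∀ a, S.D a (S.D a (S.D b f)) = S.D b (S.D a (S.D a f)) + S.x a * S.D b (S.D a f)
      - S.x b * S.D a (S.D a f) + S.D a (S.x a * S.D b f - S.x b * S.D a f) := by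
    intro a
    rw [S.D_comm a b f, add_sub_assoc, map_add, S.D_comm a b (S.D a f)]
  simp only [dvg, hess, lap, Fin.sum_univ_three, map_add, hc]
  simp only [map_sub, Derivation.leibniz, smul_eq_mul, S.D_x, Fin.sum_univ_three] at h0 h1 h2 h3 ⊢
  fin_cases b <;> simp at h2 ⊢
  · linear_combination h2 + h3 0 - S.D 0 f * h1
  · linear_combination h2 + h3 1 - S.D 1 f * h1
  · linear_combination h2 + h3 2 - S.D 2 f * h1

theorem hess_symm (f : A) (a b : Fin 3) : S.hess f a b = S.hess f b a := by
  rw [hess, hess, S.D_comm a b]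
  ring

theorem sum_x_mul_hess (f : A) (b : Fin 3) : ∑ a, S.x a * S.hess f a b = 0 := by
  have h0 := S.sum_x_mul_D f
  have h1 := S.sum_x_mul_D (S.D b f)
  simp only [hess, Fin.sum_univ_three] at h0 h1 ⊢
  linear_combination h1 + S.x b * h0

theorem trace_hess (f : A) : ∑ a, S.hess f a a = S.lap f := by
  have h0 := S.sum_x_mul_D f
  simp only [hess, lap, Fin.sum_univ_three] at h0 ⊢
  linear_combination h0

/-- Twice the trace-free part of the Hessian. -/
def hessTF (f : A) (a b : Fin 3) : A := 2 * S.hess f a b - S.met a b * S.lap f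

/-- Twice the co-closed symmetric traceless tensor with a given potential. -/
def rotHess (f : A) (a b : Fin 3) : A :=
  ∑ e, (S.eps a e * S.hess f e b + S.eps b e * S.hess f e a)

theorem isSTT_hessTF (f : A) : IsSTT S (S.hessTF f) where
  symm a b := by
    rw [hessTF, hessTF, S.hess_symm f a b, met, met]
    simp only [eq_comm (a := a)]
    ring
  tangent b := by
    have h0 := S.sum_x_mul_hess f b
    have h1 := S.sum_x_mul_x
    simp only [hessTF, met, Fin.sum_univ_three] at h0 h1 ⊢
    fin_cases b <;> simp at h0 ⊢
    · linear_combination 2 * h0 + S.x 0 * S.lap f * h1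
    · linear_combination 2 * h0 + S.x 1 * S.lap f * h1
    · linear_combination 2 * h0 + S.x 2 * S.lap f * h1
  traceless := by
    have h0 := S.trace_hess f
    have h1 := S.sum_x_mul_x
    simp only [hessTF, met, Fin.sum_univ_three, if_true] at h0 h1 ⊢
    linear_combination 2 * h0 + S.lap f * h1

/-- Removing the trace cancels the normal part of `sum_D_hess`, so the result is a pure gradient. -/
theorem dvg_hessTF (f : A) (b : Fin 3) :
    S.dvg (S.hessTF f) b = S.D b (S.lap f + 2 * f) := by
  have h0 := S.sum_D_hess f b
  have h1 := S.sum_x_mul_x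
  have h2 := S.sum_x_mul_D (S.lap f)
  have two : ∀ a, S.D a (2 : A) = 0 := fun a => by
    simpa using (S.D a).map_natCast 2
  simp only [dvg, hessTF, met, Fin.sum_univ_three, map_sub, map_add, Derivation.leibniz,
    smul_eq_mul, S.D_x, two] at h0 h1 h2 ⊢
  fin_cases b <;> simp at h0 ⊢
  · linear_combination 2 * h0 - 2 * S.x 0 * S.lap f * h1 + S.x 0 * h2
  · linear_combination 2 * h0 - 2 * S.x 1 * S.lap f * h1 + S.x 1 * h2
  · linear_combination 2 * h0 - 2 * S.x 2 * S.lap f * h1 + S.x 2 * h2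

theorem isSTT_rotHess (f : A) : IsSTT S (S.rotHess f) where
  symm a b := by
    simp only [rotHess, add_comm]
  tangent b := by
    have h0 := S.sum_x_mul_hess f
    simp only [rotHess, Fin.sum_univ_three] at h0 ⊢
    simp only [eps]
    have h00 := h0 0
    have h01 := h0 1
    have h02 := h0 2
    have s1 := S.hess_symm f 0 1
    have s2 := S.hess_symm f 0 2
    have s3 := S.hess_symm f 1 2
    simp only [s1, s2, s3] at h00 h01 h02
    fin_cases b <;> simp [s1, s2, s3]
    · linear_combination S.x 2 * h01 - S.x 1 * h02
    · linear_combination S.x 0 * h02 - S.x 2 * h00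
    · linear_combination S.x 1 * h00 - S.x 0 * h01
  traceless := by
    simp only [rotHess, Fin.sum_univ_three, eps]
    rw [S.hess_symm f 1 0, S.hess_symm f 2 0, S.hess_symm f 2 1]
    simp
    ring

theorem sum_D_eps (e : Fin 3) : ∑ a, S.D a (S.eps a e) = 0 := by
  simp only [Fin.sum_univ_three, eps]
  fin_cases e <;> simp [S.D_x] <;> ring

theorem sum_eps_mul_D_D (f : A) : ∑ a, ∑ e, S.eps a e * S.D a (S.D e f) = 0 := by
  simp only [Fin.sum_univ_three, eps]
  rw [S.D_comm 1 0, S.D_comm 2 0, S.D_comm 2 1]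
  simp
  ring

theorem sum_eps_mul_x (b : Fin 3) : ∑ e, S.eps b e * S.x e = 0 := by
  simp only [Fin.sum_univ_three, eps]
  fin_cases b <;> simp <;> ring

theorem sum_x_mul_eps (b : Fin 3) : ∑ e, S.x e * S.eps e b = 0 := by
  simp only [Fin.sum_univ_three, eps]
  fin_cases b <;> simp <;> ring

/-- Here `ε` antisymmetrises the two outer derivatives of `f`, so only curvature remains and the
right side is of first order. -/
theorem sum_D_eps_mul_hess (f : A) (b : Fin 3) :
    ∑ a, S.D a (∑ e, S.eps a e * S.hess f e b) = ∑ c, S.eps b c * S.D c f := by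
  have h1 := S.sum_eps_mul_D_D (S.D b f)
  have h2 := S.sum_eps_mul_D_D f
  have h3 := S.sum_D_eps
  have h4 := S.sum_x_mul_eps
  have e0 := h4 0
  have e1 := h4 1
  have e2 := h4 2
  have d0 := h3 0
  have d1 := h3 1
  have d2 := h3 2
  simp only [hess, Fin.sum_univ_three, map_add, Derivation.leibniz, smul_eq_mul,
    S.D_x] at *
  fin_cases b <;> simp at *
  · linear_combination h1 + S.x 0 * h2 + (S.D 0 (S.D 0 f) + S.x 0 * S.D 0 f) * d0
      + (S.D 1 (S.D 0 f) + S.x 0 * S.D 1 f) * d1 + (S.D 2 (S.D 0 f) + S.x 0 * S.D 2 f) * d2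
      - S.x 0 * (S.D 0 f * e0 + S.D 1 f * e1 + S.D 2 f * e2)
  · linear_combination h1 + S.x 1 * h2 + (S.D 0 (S.D 1 f) + S.x 1 * S.D 0 f) * d0
      + (S.D 1 (S.D 1 f) + S.x 1 * S.D 1 f) * d1 + (S.D 2 (S.D 1 f) + S.x 1 * S.D 2 f) * d2
      - S.x 1 * (S.D 0 f * e0 + S.D 1 f * e1 + S.D 2 f * e2)
  · linear_combination h1 + S.x 2 * h2 + (S.D 0 (S.D 2 f) + S.x 2 * S.D 0 f) * d0
      + (S.D 1 (S.D 2 f) + S.x 2 * S.D 1 f) * d1 + (S.D 2 (S.D 2 f) + S.x 2 * S.D 2 f) * d2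
      - S.x 2 * (S.D 0 f * e0 + S.D 1 f * e1 + S.D 2 f * e2)

/-- Here the divergence reaches the Hessian and `sum_D_hess` applies. Its normal part is killed by
`ε`, and the derivative of `ε` drops out against the symmetric tangential Hessian. -/
theorem sum_D_eps_mul_hess' (f : A) (b : Fin 3) :
    ∑ a, S.D a (∑ e, S.eps b e * S.hess f e a) =
      ∑ c, S.eps b c * (S.D c (S.lap f) + S.D c f) := by
  have hd := S.sum_D_hess f
  have d0 := hd 0
  have d1 := hd 1
  have d2 := hd 2
  have hx := S.sum_x_mul_hess f
  have hx0 := hx 0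
  have hx1 := hx 1
  have hx2 := hx 2
  have he := S.sum_eps_mul_x b
  have s1 := S.hess_symm f 0 1
  have s2 := S.hess_symm f 0 2
  have s3 := S.hess_symm f 1 2
  simp only [dvg, Fin.sum_univ_three, map_add, Derivation.leibniz, smul_eq_mul, s1, s2, s3] at *
  simp only [eps] at *
  fin_cases b <;> simp [S.D_x] at *
  · linear_combination S.x 2 * d1 - S.x 1 * d2 - S.x 2 * hx1 + S.x 1 * hx2
  · linear_combination - S.x 2 * d0 + S.x 0 * d2 + S.x 2 * hx0 - S.x 0 * hx2
  · linear_combination S.x 1 * d0 - S.x 0 * d1 - S.x 1 * hx0 + S.x 0 * hx1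

theorem dvg_rotHess (f : A) (b : Fin 3) :
    S.dvg (S.rotHess f) b = ∑ c, S.eps b c * S.D c (S.lap f + 2 * f) := by
  simp only [dvg, rotHess, Finset.sum_add_distrib, map_add]
  rw [S.sum_D_eps_mul_hess, S.sum_D_eps_mul_hess', ← Finset.sum_add_distrib]
  refine Finset.sum_congr rfl fun c _ => ?_
  rw [two_mul, map_add]
  ring

/-! ### Uniqueness of the shear potentials -/

theorem eq_zero_of_int_sum_mul_self {w : Fin 3 → A} (h : S.int (∑ a, w a * w a) = 0) (a : Fin 3) :
    w a = 0 := by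
  rw [map_sum, Finset.sum_eq_zero_iff_of_nonneg fun b _ => S.int_mul_self_nonneg (w b)] at h
  exact S.eq_zero_of_int_mul_self _ (h a (Finset.mem_univ a))

theorem eq_zero_of_D_eq_zero {f : A} (hf : ∀ a, S.D a f = 0) (h0 : S.int f = 0) : f = 0 := by
  obtain ⟨r, hr⟩ := S.eq_const_of_D_eq_zero f hf
  apply S.eq_zero_of_int_mul_self
  nth_rewrite 1 [hr]
  rw [← Algebra.smul_def, map_smul, h0, smul_zero]

theorem int_lap (f : A) : S.int (S.lap f) = 0 := S.int_div (S.sum_x_mul_D f)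

theorem D_two (a : Fin 3) : S.D a (2 : A) = 0 := by simpa using (S.D a).map_natCast 2

theorem eq_zero_of_two_mul {f : A} (h : 2 * f = 0) : f = 0 := by
  have : (2 : ℝ) • f = 0 := by rw [Algebra.smul_def, map_ofNat, h]
  simpa using this

/-- A first spherical harmonic which is orthogonal to the coordinates vanishes. -/
theorem eq_zero_of_lap_add_two_mul {d : A} (h : S.lap d + 2 * d = 0)
    (hx : ∀ a, S.int (d * S.x a) = 0) : d = 0 := by
  have hT := S.isSTT_hessTF d
  have hdiv : ∀ b, S.dvg (S.hessTF d) b = 0 := fun b => by rw [dvg_hessTF, h, map_zero]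
  have hint : S.int (∑ a, ∑ b, S.hessTF d a b * S.hessTF d a b) = 0 := by
    -- Since `hessTF d` is trace-free and divergence-free, its squared norm is the divergence of `2
    -- hessTF d · ∇d`.
    refine S.int_eq_zero_of_eq_div (fun a => 2 * ∑ b, S.hessTF d a b * S.D b d) ?_ ?_
    · have t0 := hT.tangent 0
      have t1 := hT.tangent 1
      have t2 := hT.tangent 2
      simp only [Fin.sum_univ_three] at *
      linear_combination 2 * (S.D 0 d * t0 + S.D 1 d * t1 + S.D 2 d * t2)
    · have key : ∀ a b, S.hessTF d a b * S.hessTF d a b =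
          2 * S.hessTF d a b * S.D a (S.D b d) + 2 * S.D a d * (S.x b * S.hessTF d b a)
          + S.lap d * (S.x b * (S.x a * S.hessTF d a b))
          - S.lap d * (if a = b then S.hessTF d a b else 0) := by
        intro a b
        rw [hT.symm b a]
        nth_rewrite 2 [hessTF]
        simp only [hess, met]
        split_ifs <;> ring
      simp only [key, Finset.sum_add_distrib, Finset.sum_sub_distrib, ← Finset.mul_sum,
        hT.tangent, Finset.sum_ite_eq, Finset.mem_univ, if_true, hT.traceless]
      have h1 : ∑ a, ∑ b, S.x b * (S.x a * S.hessTF d a b) = 0 := by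
        rw [Finset.sum_comm]
        simp only [← Finset.mul_sum, hT.tangent, mul_zero, Finset.sum_const_zero]
      have v0 := hdiv 0
      have v1 := hdiv 1
      have v2 := hdiv 2
      simp only [dvg, ← Finset.mul_sum, mul_zero, Finset.sum_const_zero, add_zero, sub_zero,
        Fin.sum_univ_three, Derivation.leibniz, smul_eq_mul, map_add, S.D_two] at *
      linear_combination S.lap d * h1 - 2 * (S.D 0 d * v0 + S.D 1 d * v1 + S.D 2 d * v2)
  have hzero : ∀ a b, S.hessTF d a b = 0 := by
    intro a
    refine S.eq_zero_of_int_sum_mul_self ?_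
    rw [map_sum, Finset.sum_eq_zero_iff_of_nonneg] at hint
    · exact hint a (Finset.mem_univ a)
    · intro c _
      rw [map_sum]
      exact Finset.sum_nonneg fun b _ => S.int_mul_self_nonneg _
  -- Given `Δd = -2d`, this derivative is half of `hessTF d`. So `∇d + d x` is a constant vector
  -- `r`, and contracting with `x` shows that `d = r·x`.
  have hD : ∀ b a, S.D a (S.D b d + S.x b * d) = 0 := by
    intro b a
    apply eq_zero_of_two_mul
    have := hzero a b
    simp only [hessTF, hess, met, map_add, Derivation.leibniz, smul_eq_mul, S.D_x] at this ⊢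
    linear_combination this + ((if a = b then 1 else 0) - S.x a * S.x b) * h
  choose r hr using fun b => S.eq_const_of_D_eq_zero _ (hD b)
  have hd : d = ∑ b, r b • S.x b := by
    have h0 := S.sum_x_mul_D d
    have h1 := S.sum_x_mul_x
    simp only [Algebra.smul_def, ← hr, Fin.sum_univ_three] at h0 h1 ⊢
    linear_combination - h0 - d * h1
  apply S.eq_zero_of_int_mul_self
  nth_rewrite 2 [hd]
  rw [Finset.mul_sum, map_sum]
  refine Finset.sum_eq_zero fun b _ => ?_
  rw [mul_smul_comm, map_smul, hx, smul_zero]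

/-- On tangent vectors `ε` is a quarter turn, so applying it once more recovers the gradient up to
sign. -/
theorem D_eq_zero_of_sum_eps_mul_D {q : A} (h : ∀ b, ∑ c, S.eps b c * S.D c q = 0) (a : Fin 3) :
    S.D a q = 0 := by
  have h0 := h 0
  have h1 := h 1
  have h2 := h 2
  have hq := S.sum_x_mul_D q
  have hx := S.sum_x_mul_x
  simp only [eps, Fin.sum_univ_three] at h0 h1 h2 hq hx
  fin_cases a <;> simp at *
  · linear_combination S.x 0 * hq - S.D 0 q * hx - S.x 2 * h1 + S.x 1 * h2
  · linear_combination S.x 1 * hq - S.D 1 q * hx + S.x 2 * h0 - S.x 0 * h2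
  · linear_combination S.x 2 * hq - S.D 2 q * hx - S.x 1 * h0 + S.x 0 * h1

/-- Potentials supported in the modes `ℓ ≥ 2` are unique. -/
theorem potentials_eq_zero {d e : A} (h : ∀ a b, S.hessTF d a b + S.rotHess e a b = 0)
    (hd : S.int d = 0) (hdx : ∀ a, S.int (d * S.x a) = 0)
    (he : S.int e = 0) (hex : ∀ a, S.int (e * S.x a) = 0) : d = 0 ∧ e = 0 := by
  set p := S.lap d + 2 * d with hp
  set q := S.lap e + 2 * e with hq
  have hdiv : ∀ b, S.D b p + ∑ c, S.eps b c * S.D c q = 0 := by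
    intro b
    rw [hp, hq, ← S.dvg_hessTF, ← S.dvg_rotHess, dvg, dvg, ← Finset.sum_add_distrib]
    simp only [← map_add, h, map_zero, Finset.sum_const_zero]
  have hw : ∑ a, S.x a * ∑ c, S.eps a c * S.D c q = 0 := by
    have e0 := S.sum_x_mul_eps 0
    have e1 := S.sum_x_mul_eps 1
    have e2 := S.sum_x_mul_eps 2
    simp only [Fin.sum_univ_three] at *
    linear_combination S.D 0 q * e0 + S.D 1 q * e1 + S.D 2 q * e2
  have hdw : ∑ a, S.D a (∑ c, S.eps a c * S.D c q) = 0 := by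
    have e0 := S.sum_D_eps 0
    have e1 := S.sum_D_eps 1
    have e2 := S.sum_D_eps 2
    have e3 := S.sum_eps_mul_D_D q
    simp only [Fin.sum_univ_three, map_add, Derivation.leibniz, smul_eq_mul] at *
    linear_combination S.D 0 q * e0 + S.D 1 q * e1 + S.D 2 q * e2 + e3
  -- The field `ε∇q` is divergence-free, hence orthogonal to `∇p`; as `ε∇q = -∇p`, this gives
  -- `∫|∇p|² = 0`.
  have hDp : ∀ a, S.D a p = 0 := by
    refine S.eq_zero_of_int_sum_mul_self ?_
    have := S.int_sum_mul_D hw p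
    rw [hdw, mul_zero, map_zero, neg_zero] at this
    rw [← neg_eq_zero, ← map_neg, ← Finset.sum_neg_distrib, ← this]
    congr 1
    refine Finset.sum_congr rfl fun a _ => ?_
    linear_combination (- S.D a p) * hdiv a
  have hDq : ∀ a, S.D a q = 0 := by
    refine S.D_eq_zero_of_sum_eps_mul_D fun b => ?_
    simpa [hDp b] using hdiv b
  have hint : ∀ g, S.int g = 0 → S.int (S.lap g + 2 * g) = 0 := by
    intro g hg
    rw [map_add, S.int_lap, two_mul, map_add, hg]
    simp
  exact ⟨S.eq_zero_of_lap_add_two_mul (S.eq_zero_of_D_eq_zero hDp (hint d hd)) hdx,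
    S.eq_zero_of_lap_add_two_mul (S.eq_zero_of_D_eq_zero hDq (hint e he)) hex⟩

/-! ### Integration of the shear terms against rotation and conformal fields -/

theorem sum_x_mul_curl {t : Fin 3 → A} (ht : ∑ a, S.x a * t a = 0) (a : Fin 3) :
    ∑ b, S.x b * S.curl t b a = 0 := by
  have hx := S.sum_x_mul_x
  have h0 := S.sum_x_mul_D (t a)
  have h1 := congrArg (S.D a) ht
  simp only [curl, Fin.sum_univ_three, map_add, Derivation.leibniz, smul_eq_mul, S.D_x,
    map_zero] at *
  fin_cases a <;> simp at *
  · linear_combination h0 - h1 - t 0 * hx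
  · linear_combination h0 - h1 - t 1 * hx
  · linear_combination h0 - h1 - t 2 * hx

/-- Moving the divergence off `P` uses up one of the three terms `P∇f` and puts one derivative on
`V`. -/
theorem int_mul_dvg_curl {P : Fin 3 → Fin 3 → A} (hP : ∀ a, ∑ b, S.x b * P b a = 0)
    (f : A) (V : Fin 3 → A) :
    S.int (∑ a, V a * (f * S.dvg P a + 3 * ∑ b, P b a * S.D b f)) =
      S.int (2 * ∑ a, ∑ b, P b a * S.D b f * V a - f * ∑ a, ∑ b, P b a * S.D b (V a)) := by
  refine S.int_eq_of_sub_eq_div (fun b => ∑ a, f * V a * P b a) ?_ ?_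
  · have h0 := hP 0
    have h1 := hP 1
    have h2 := hP 2
    simp only [Fin.sum_univ_three] at *
    linear_combination f * (V 0 * h0 + V 1 * h1 + V 2 * h2)
  · simp only [dvg, Fin.sum_univ_three, map_add, Derivation.leibniz, smul_eq_mul]
    ring

/-- Moves the derivatives off `t` by means of the divergence of `(t·V)∇f - (t·∇f)V`. -/
theorem int_curl_mul_D_mul (t : Fin 3 → A) {V : Fin 3 → A}
    (hV : ∑ a, S.x a * V a = 0) (f : A) :
    S.int (∑ a, ∑ b, S.curl t b a * S.D b f * V a) =
      S.int (- S.lap f * ∑ a, V a * t a - ∑ a, ∑ b, t a * S.D b f * S.D b (V a)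
        + ∑ a, ∑ b, V a * t b * S.D a (S.D b f)
        + (∑ b, t b * S.D b f) * ∑ a, S.D a (V a)) := by
  have hf := S.sum_x_mul_D f
  refine S.int_eq_of_sub_eq_div
    (fun b => (∑ a, t a * V a) * S.D b f - (∑ a, t a * S.D a f) * V b) ?_ ?_
  · simp only [Fin.sum_univ_three] at *
    linear_combination (t 0 * V 0 + t 1 * V 1 + t 2 * V 2) * hf
      - (t 0 * S.D 0 f + t 1 * S.D 1 f + t 2 * S.D 2 f) * hV
  · simp only [curl, lap, Fin.sum_univ_three, map_add, map_sub, Derivation.leibniz,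
      smul_eq_mul] at *
    linear_combination (t 0 * S.D 0 f + t 1 * S.D 1 f + t 2 * S.D 2 f) * hV
      - (t 0 * V 0 + t 1 * V 1 + t 2 * V 2) * hf

-- The normal component of the ambient divergence is minus the trace, hence zero; this is why `dvg`
-- agrees with the covariant divergence on such tensors.
variable {S} in

theorem IsSTT.sum_x_mul_dvg {C : Fin 3 → Fin 3 → A} (hC : IsSTT S C) :
    ∑ b, S.x b * S.dvg C b = 0 := by
  have h := fun a => congrArg (S.D a) (hC.tangent a)
  have h0 := h 0
  have h1 := h 1
  have h2 := h 2
  have ht := hC.traceless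
  have t0 := hC.tangent 0
  have t1 := hC.tangent 1
  have t2 := hC.tangent 2
  simp only [dvg, Fin.sum_univ_three, map_add, Derivation.leibniz, smul_eq_mul, S.D_x, map_zero,
    hC.symm 1 0, hC.symm 2 0, hC.symm 2 1] at *
  simp at *
  linear_combination h0 + h1 + h2 - ht + S.x 0 * t0 + S.x 1 * t1 + S.x 2 * t2

-- The hypothesis `hV` holds for conformal Killing fields, whose covariant derivative has no
-- symmetric trace-free part; the term with `∇V` then drops out.
variable {S} in
theorem IsSTT.int_mul_D {C : Fin 3 → Fin 3 → A} (hC : IsSTT S C) {V : Fin 3 → A}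
    (hV : ∑ a, ∑ b, S.D b (V a) * C a b = 0) (g : A) :
    S.int (∑ a, V a * ∑ b, C a b * S.D b g) = - S.int (g * ∑ a, V a * S.dvg C a) := by
  rw [← map_neg]
  refine S.int_eq_of_sub_eq_div (fun b => g * ∑ a, V a * C a b) ?_ ?_
  · have t0 := hC.tangent 0
    have t1 := hC.tangent 1
    have t2 := hC.tangent 2
    simp only [Fin.sum_univ_three, hC.symm 1 0, hC.symm 2 0, hC.symm 2 1] at *
    linear_combination g * (V 0 * t0 + V 1 * t1 + V 2 * t2)
  · simp only [dvg, Fin.sum_univ_three, map_add, Derivation.leibniz,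
      smul_eq_mul, hC.symm 1 0, hC.symm 2 0, hC.symm 2 1] at *
    linear_combination (-g) * hV

theorem sum_mul_hessTF_mul {t : Fin 3 → A} (ht : ∑ a, S.x a * t a = 0)
    (V : Fin 3 → A) (f : A) :
    ∑ a, V a * ∑ b, S.hessTF f a b * t b =
      2 * ∑ a, ∑ b, V a * t b * S.D a (S.D b f) - S.lap f * ∑ a, V a * t a := by
  simp only [hessTF, hess, met, Fin.sum_univ_three] at *
  simp
  linear_combination (2 * (V 0 * S.D 0 f + V 1 * S.D 1 f + V 2 * S.D 2 f)
    + S.lap f * (S.x 0 * V 0 + S.x 1 * V 1 + S.x 2 * V 2)) * ht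

/-- The change of the shear under a supertranslation. -/
def shearShift (f : A) (a b : Fin 3) : A := - S.hessTF f a b

theorem isSTT_shearShift (f : A) : IsSTT S (S.shearShift f) where
  symm a b := by simp only [shearShift, (S.isSTT_hessTF f).symm a b]
  tangent b := by
    simp only [shearShift, mul_neg, Finset.sum_neg_distrib, (S.isSTT_hessTF f).tangent, neg_zero]
  traceless := by
    simp only [shearShift, Finset.sum_neg_distrib, (S.isSTT_hessTF f).traceless, neg_zero]

theorem dvg_shearShift (f : A) (b : Fin 3) :
    S.dvg (S.shearShift f) b = - S.D b (S.lap f + 2 * f) := by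
  rw [← dvg_hessTF]
  simp only [dvg, shearShift, map_neg, Finset.sum_neg_distrib]

/-- The integral of the terms that are quadratic in `C` and `H`, for a divergence-free shift. -/
theorem int_mul_quadratic {C : Fin 3 → Fin 3 → A} (hC : IsSTT S C) {V : Fin 3 → A}
    (hVT : ∀ T, IsSTT S T → ∑ a, ∑ b, S.D b (V a) * T a b = 0) (f : A) :
    S.int (∑ a, V a * (∑ b, (C a b + S.shearShift f a b) * (S.dvg C b + S.dvg (S.shearShift f) b)
        - ∑ b, C a b * S.dvg C b)) =
      S.int (2 * (S.lap f + f) * ∑ a, V a * S.dvg C a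
        - 2 * ∑ a, ∑ b, V a * S.dvg C b * S.D a (S.D b f)
        - (S.lap f + 2 * f) * ∑ a, V a * S.D a (S.lap f + 2 * f)) := by
  have h1 := S.sum_mul_hessTF_mul hC.sum_x_mul_dvg V f
  have h2 := hC.int_mul_D (hVT _ hC) (S.lap f + 2 * f)
  have h3 := (S.isSTT_shearShift f).int_mul_D (hVT _ (S.isSTT_shearShift f)) (S.lap f + 2 * f)
  have e : ∑ a, V a * (∑ b, (C a b + S.shearShift f a b) *
        (S.dvg C b + S.dvg (S.shearShift f) b) - ∑ b, C a b * S.dvg C b) =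
      - (∑ a, V a * ∑ b, S.hessTF f a b * S.dvg C b)
      - (∑ a, V a * ∑ b, C a b * S.D b (S.lap f + 2 * f))
      - (∑ a, V a * ∑ b, S.shearShift f a b * S.D b (S.lap f + 2 * f)) := by
    simp only [dvg_shearShift, Fin.sum_univ_three]
    simp only [shearShift]
    ring
  rw [e, h1, map_sub, map_sub, h2, h3, sub_neg_eq_add, sub_neg_eq_add, ← map_add, ← map_add]
  congr 1
  simp only [dvg_shearShift, Fin.sum_univ_three]
  ring

/-- In Cartesian components a rotation field is a constant antisymmetric matrix applied to `x`, so
its derivative is that matrix up to a normal term. -/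
theorem D_rotation {E : Fin 3 → Fin 3 → A} {Y : Fin 3 → A} (hE : ∀ c a b, S.D c (E a b) = 0)
    (hY : ∀ a, Y a = ∑ c, E a c * S.x c) (b a : Fin 3) :
    S.D b (Y a) = E a b - S.x b * Y a := by
  simp only [hY, Fin.sum_univ_three, map_add, Derivation.leibniz, smul_eq_mul, S.D_x, hE]
  fin_cases b <;> simp <;> ring

theorem sum_x_mul_rotation {E : Fin 3 → Fin 3 → A} {Y : Fin 3 → A} (hEs : ∀ a b, E a b = - E b a)
    (hY : ∀ a, Y a = ∑ c, E a c * S.x c) : ∑ a, S.x a * Y a = 0 := by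
  apply eq_zero_of_two_mul
  have h00 := hEs 0 0
  have h11 := hEs 1 1
  have h22 := hEs 2 2
  simp only [hY, Fin.sum_univ_three, hEs 1 0, hEs 2 0, hEs 2 1]
  linear_combination S.x 0 * S.x 0 * h00 + S.x 1 * S.x 1 * h11 + S.x 2 * S.x 2 * h22

/-- The terms of a supertranslated charge density that do not involve the mass aspect. -/
def shearDensity (C : Fin 3 → Fin 3 → A) (f : A) (a : Fin 3) : A :=
  f * S.dvg (S.curl (S.dvg C)) a + 3 * ∑ b, S.curl (S.dvg C) b a * S.D b f
    + (∑ b, (C a b + S.shearShift f a b) * (S.dvg C b + S.dvg (S.shearShift f) b)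
        - ∑ b, C a b * S.dvg C b)

/-- The second derivatives of `f` paired with `dvg C` arise twice with opposite signs, from the curl
terms and from the cross terms of the quadratic part. What survives is of first order in `f`, or
quadratic in `Δf + 2f`. -/
theorem int_mul_shearDensity {C : Fin 3 → Fin 3 → A} (hC : IsSTT S C) {V : Fin 3 → A}
    (hV : ∑ a, S.x a * V a = 0)
    (hVT : ∀ T, IsSTT S T → ∑ a, ∑ b, S.D b (V a) * T a b = 0) (f : A) :
    S.int (∑ a, V a * S.shearDensity C f a) =
      S.int (2 * (f * ∑ a, V a * S.dvg C a - ∑ a, ∑ b, S.dvg C a * S.D b f * S.D b (V a)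
          + (∑ b, S.dvg C b * S.D b f) * ∑ a, S.D a (V a))
        - f * ∑ a, ∑ b, S.curl (S.dvg C) b a * S.D b (V a)
        - (S.lap f + 2 * f) * ∑ a, V a * S.D a (S.lap f + 2 * f)) := by
  have h1 := S.int_mul_dvg_curl (S.sum_x_mul_curl hC.sum_x_mul_dvg) f V
  have h2 := S.int_curl_mul_D_mul (S.dvg C) hV f
  have h3 := S.int_mul_quadratic hC hVT f
  simp only [shearDensity, mul_add (V _) (_ + _),
    Finset.sum_add_distrib (g := fun a => V a * (_ - _)),
    map_add S.int (∑ a, V a * (_ + _))]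
  rw [h1, h3, two_mul (∑ a, ∑ b, _ * _ * V a), map_sub, map_add, h2]
  simp only [← map_add, ← map_sub]
  congr 1
  ring

theorem int_rotation_mul_shearDensity {E : Fin 3 → Fin 3 → A} {Y : Fin 3 → A}
    (hE : ∀ c a b, S.D c (E a b) = 0) (hEs : ∀ a b, E a b = - E b a)
    (hY : ∀ a, Y a = ∑ c, E a c * S.x c) {C : Fin 3 → Fin 3 → A} (hC : IsSTT S C) (f : A) :
    S.int (∑ a, Y a * S.shearDensity C f a) = 0 := by
  have hD := S.D_rotation hE hY
  have hxY := S.sum_x_mul_rotation hEs hY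
  have hE0 : ∀ a, E a a = 0 := fun a => eq_zero_of_two_mul (by linear_combination hEs a a)
  have hdY : ∑ a, S.D a (Y a) = 0 := by
    simp only [hD, hE0, Fin.sum_univ_three] at hxY ⊢
    linear_combination - hxY
  have hYT : ∀ T, IsSTT S T → ∑ a, ∑ b, S.D b (Y a) * T a b = 0 := by
    intro T hT
    have t0 := hT.tangent 0
    have t1 := hT.tangent 1
    have t2 := hT.tangent 2
    simp only [hD, hE0, Fin.sum_univ_three, hT.symm 1 0, hT.symm 2 0, hT.symm 2 1, hEs 1 0,
      hEs 2 0, hEs 2 1] at t0 t1 t2 ⊢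
    linear_combination - (Y 0 * t0 + Y 1 * t1 + Y 2 * t2)
  set t := S.dvg C with ht
  have hxt : ∑ a, S.x a * t a = 0 := hC.sum_x_mul_dvg
  have hxP := S.sum_x_mul_curl hxt
  have h1 := S.int_mul_shearDensity hC hxY hYT f
  -- Subtracting `x b * (Y·t)` in the field below makes it tangential, since the normal component of
  -- `∑ a, E a b * t a` is `Y·t`.
  have h4 : S.int (f * ∑ a, ∑ b, E a b * S.D b (t a)) =
      S.int (2 * f * ∑ a, Y a * t a - ∑ a, ∑ b, E a b * t a * S.D b f) := by
    refine S.int_eq_of_sub_eq_div (fun b => f * (∑ a, E a b * t a - S.x b * ∑ a, Y a * t a)) ?_ ?_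
    · have hx := S.sum_x_mul_x
      simp only [hY, Fin.sum_univ_three] at *
      linear_combination (- f * ((E 0 0 * S.x 0 + E 0 1 * S.x 1 + E 0 2 * S.x 2) * t 0
        + (E 1 0 * S.x 0 + E 1 1 * S.x 1 + E 1 2 * S.x 2) * t 1
        + (E 2 0 * S.x 0 + E 2 1 * S.x 1 + E 2 2 * S.x 2) * t 2)) * hx
    · have hx := S.sum_x_mul_x
      have hf := S.sum_x_mul_D f
      have hYt := S.sum_x_mul_D (∑ a, Y a * t a)
      simp only [Fin.sum_univ_three, map_add, map_sub, Derivation.leibniz, smul_eq_mul, S.D_x,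
        hE, if_true] at *
      linear_combination f * hYt + (Y 0 * t 0 + Y 1 * t 1 + Y 2 * t 2) * hf
        - f * (Y 0 * t 0 + Y 1 * t 1 + Y 2 * t 2) * hx
  -- For `g = Δf + 2f` the integrand is `½ div(g² Y)`, because `Y` is divergence-free.
  have h5 : S.int ((S.lap f + 2 * f) * ∑ a, Y a * S.D a (S.lap f + 2 * f)) = 0 := by
    have : S.int (2 * ((S.lap f + 2 * f) * ∑ a, Y a * S.D a (S.lap f + 2 * f))) = 0 := by
      refine S.int_eq_zero_of_eq_div
        (fun a => (S.lap f + 2 * f) * (S.lap f + 2 * f) * Y a) ?_ ?_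
      · simp only [Fin.sum_univ_three] at *
        linear_combination (S.lap f + 2 * f) * (S.lap f + 2 * f) * hxY
      · generalize S.lap f + 2 * f = g
        simp only [Fin.sum_univ_three, Derivation.leibniz, smul_eq_mul] at *
        linear_combination (- g * g) * hdY
    rw [two_mul, map_add] at this
    linarith
  have e1 : ∑ a, ∑ b, S.curl t b a * S.D b (Y a) =
      2 * ∑ a, ∑ b, E a b * S.D b (t a) - 2 * ∑ a, Y a * t a := by
    have p0 := hxP 0
    have p1 := hxP 1
    have p2 := hxP 2
    simp only [hD, Fin.sum_univ_three]
    simp only [Fin.sum_univ_three, hY, curl, hE0, hEs 1 0, hEs 2 0, hEs 2 1] at p0 p1 p2 ⊢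
    linear_combination (- (0 * S.x 0 + E 0 1 * S.x 1 + E 0 2 * S.x 2)) * p0
      - (-E 0 1 * S.x 0 + 0 * S.x 1 + E 1 2 * S.x 2) * p1
      - (-E 0 2 * S.x 0 - E 1 2 * S.x 1 + 0 * S.x 2) * p2
  have e2 : ∑ a, ∑ b, t a * S.D b f * S.D b (Y a) = ∑ a, ∑ b, E a b * t a * S.D b f := by
    have hf := S.sum_x_mul_D f
    simp only [hD, Fin.sum_univ_three] at *
    linear_combination (- (Y 0 * t 0 + Y 1 * t 1 + Y 2 * t 2)) * hf
  rw [h1, ← ht, e1, hdY, e2, map_sub, h5]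
  rw [show f * (2 * ∑ a, ∑ b, E a b * S.D b (t a) - 2 * ∑ a, Y a * t a) =
    f * ∑ a, ∑ b, E a b * S.D b (t a) + f * ∑ a, ∑ b, E a b * S.D b (t a)
      - 2 * f * ∑ a, Y a * t a by ring, map_sub, map_sub, map_add, h4]
  simp only [← map_add, ← map_sub, sub_zero]
  rw [← map_zero S.int]
  congr 1
  ring

/-- The covariant Hessian of a coordinate is pure trace, so `∇X^k` is a conformal Killing field; the
last term is the normal correction. -/
theorem D_D_x (k b a : Fin 3) :
    S.D b (S.D a (S.x k)) = - S.met b a * S.x k - S.x a * S.D b (S.x k) := by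
  simp only [S.D_x, map_sub, Derivation.leibniz, smul_eq_mul, met]
  split_ifs <;> simp [*] <;> ring

theorem sum_D_D_x (k : Fin 3) : ∑ a, S.D a (S.D a (S.x k)) = - (2 * S.x k) := by
  have hx := S.sum_x_mul_x
  have h := S.sum_x_mul_D (S.x k)
  simp only [D_D_x, met, Fin.sum_univ_three, if_true] at *
  linear_combination S.x k * hx - h

/-- The divergence of `X^k T·∇f` takes one derivative off `f`; where it falls on `X^k`, the
conformal Killing property allows a second integration by parts. -/
theorem int_mul_inner_shearShift {T : Fin 3 → Fin 3 → A} (hT : IsSTT S T) {f : A} {k : Fin 3}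
    (hVT : ∑ a, ∑ b, S.D b (S.D a (S.x k)) * T a b = 0) :
    S.int (S.x k * ∑ a, ∑ b, T a b * S.shearShift f a b) =
      S.int (2 * S.x k * ∑ b, S.dvg T b * S.D b f - 2 * f * ∑ a, S.D a (S.x k) * S.dvg T a) := by
  have h1 := hT.int_mul_D hVT f
  have h2 : S.int (S.x k * ∑ a, ∑ b, T a b * S.shearShift f a b) =
      S.int (2 * (S.x k * ∑ b, S.dvg T b * S.D b f)
        + 2 * ∑ a, S.D a (S.x k) * ∑ b, T a b * S.D b f) := by
    have t0 := hT.tangent 0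
    have t1 := hT.tangent 1
    have t2 := hT.tangent 2
    have tr := hT.traceless
    refine S.int_eq_of_sub_eq_div (fun a => - (2 * (S.x k * ∑ b, T a b * S.D b f))) ?_ ?_
    · simp only [Fin.sum_univ_three] at *
      linear_combination (-2 * S.x k) * (S.D 0 f * t0 + S.D 1 f * t1 + S.D 2 f * t2)
    · simp only [dvg, shearShift, hessTF, hess, met, Fin.sum_univ_three, map_add, map_neg,
        Derivation.leibniz, smul_eq_mul, S.D_two, if_true, hT.symm 1 0, hT.symm 2 0,
        hT.symm 2 1] at *
      simp only [show (0 : Fin 3) ≠ 1 by decide, show (0 : Fin 3) ≠ 2 by decide,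
        show (1 : Fin 3) ≠ 0 by decide, show (1 : Fin 3) ≠ 2 by decide,
        show (2 : Fin 3) ≠ 0 by decide, show (2 : Fin 3) ≠ 1 by decide, if_false]
      linear_combination S.x k * S.lap f * tr
        - S.x k * (2 * S.D 0 f + S.lap f * S.x 0) * t0
        - S.x k * (2 * S.D 1 f + S.lap f * S.x 1) * t1
        - S.x k * (2 * S.D 2 f + S.lap f * S.x 2) * t2
  rw [h2, two_mul (∑ a, _ * _), map_add, map_add, h1]
  simp only [← map_add, ← map_neg]
  congr 1
  ring

/-- Since `∇X^k` has divergence `-2X^k`, the shear density need not integrate to zero. The defect is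
an exact multiple of the change of `∫X^k|C|²`, which explains the term `(1/16)∇|C|²` in the center
of mass. -/
theorem int_conformal_mul_shearDensity {C : Fin 3 → Fin 3 → A} (hC : IsSTT S C) (f : A)
    (k : Fin 3) :
    2 * S.int (∑ a, S.D a (S.x k) * S.shearDensity C f a)
      + S.int (S.x k * ∑ a, ∑ b, ((C a b + S.shearShift f a b) * (C a b + S.shearShift f a b)
        - C a b * C a b)) = 0 := by
  have hxZ := S.sum_x_mul_D (S.x k)
  have hdZ := S.sum_D_D_x k
  have hH := S.isSTT_shearShift f
  have hxt := hC.sum_x_mul_dvg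
  have hZT : ∀ T, IsSTT S T → ∑ a, ∑ b, S.D b (S.D a (S.x k)) * T a b = 0 := by
    intro T hT
    have t0 := hT.tangent 0
    have t1 := hT.tangent 1
    have t2 := hT.tangent 2
    have tr := hT.traceless
    simp only [D_D_x, met, Fin.sum_univ_three, hT.symm 1 0, hT.symm 2 0, hT.symm 2 1] at *
    simp
    linear_combination (- S.x k) * tr + (S.x k * S.x 0 - S.D 0 (S.x k)) * t0
      + (S.x k * S.x 1 - S.D 1 (S.x k)) * t1 + (S.x k * S.x 2 - S.D 2 (S.x k)) * t2
  have h1 := S.int_mul_shearDensity hC hxZ hZT f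
  have e1 : ∑ a, ∑ b, S.dvg C a * S.D b f * S.D b (S.D a (S.x k)) =
      - S.x k * ∑ b, S.dvg C b * S.D b f := by
    have hf := S.sum_x_mul_D f
    simp only [D_D_x, met, Fin.sum_univ_three] at hf hxt ⊢
    simp
    linear_combination (S.x k * (S.x 0 * S.D 0 f + S.x 1 * S.D 1 f + S.x 2 * S.D 2 f)
      - (S.D 0 (S.x k) * S.D 0 f + S.D 1 (S.x k) * S.D 1 f + S.D 2 (S.x k) * S.D 2 f)) * hxt
  have e2 : ∑ a, ∑ b, S.curl (S.dvg C) b a * S.D b (S.D a (S.x k)) = 0 := by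
    have p := S.sum_x_mul_curl hxt
    have p0 := p 0
    have p1 := p 1
    have p2 := p 2
    simp only [D_D_x, met, Fin.sum_univ_three, curl] at p0 p1 p2 ⊢
    simp
    linear_combination S.D 0 (S.x k) * p0 + S.D 1 (S.x k) * p1 + S.D 2 (S.x k) * p2
  have e3 : S.x k * ∑ a, ∑ b, ((C a b + S.shearShift f a b) * (C a b + S.shearShift f a b)
        - C a b * C a b) = 2 * (S.x k * ∑ a, ∑ b, C a b * S.shearShift f a b)
        + S.x k * ∑ a, ∑ b, S.shearShift f a b * S.shearShift f a b := by
    simp only [Fin.sum_univ_three]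
    ring
  have h2 := S.int_mul_inner_shearShift hC (f := f) (hZT _ hC)
  have h3 := S.int_mul_inner_shearShift hH (f := f) (hZT _ hH)
  rw [e1, e2, hdZ] at h1
  rw [e3, two_mul (S.x k * _), map_add, map_add, h2, h3, h1, two_mul]
  simp only [← map_add]
  simp only [dvg_shearShift]
  -- The terms linear in `dvg C` now cancel. The rest involves only `f`, `X^k` and `g = Δf + 2f`,
  -- and is the divergence of the field below.
  have hg : S.lap f = (S.lap f + 2 * f) - 2 * f := by ring
  generalize S.lap f + 2 * f = g at hg ⊢
  refine S.int_eq_zero_of_eq_div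
    (fun a => (2 * f * g - g * g) * S.D a (S.x k) - 2 * S.x k * g * S.D a f) ?_ ?_
  · have hf := S.sum_x_mul_D f
    simp only [Fin.sum_univ_three] at *
    linear_combination (2 * f * g - g * g) * hxZ - 2 * S.x k * g * hf
  · rw [lap] at hg
    simp only [Fin.sum_univ_three, map_sub, Derivation.leibniz, smul_eq_mul, S.D_two] at *
    linear_combination 2 * S.x k * g * hg - (2 * f * g - g * g) * hdZ

/-! ### Low modes and the change of the potentials -/

theorem hess_add (f g : A) (a b : Fin 3) : S.hess (f + g) a b = S.hess f a b + S.hess g a b := by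
  simp only [hess, map_add]
  ring

theorem hess_smul (r : ℝ) (f : A) (a b : Fin 3) : S.hess (r • f) a b = r • S.hess f a b := by
  simp only [hess, Derivation.map_smul, smul_add, mul_smul_comm]

theorem hessTF_add (f g : A) (a b : Fin 3) :
    S.hessTF (f + g) a b = S.hessTF f a b + S.hessTF g a b := by
  simp only [hessTF, hess_add, lap, map_add, Finset.sum_add_distrib]
  ring

theorem hessTF_smul (r : ℝ) (f : A) (a b : Fin 3) :
    S.hessTF (r • f) a b = r • S.hessTF f a b := by
  simp only [hessTF, hess_smul, lap, Derivation.map_smul, smul_sub, mul_smul_comm,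
    ← Finset.smul_sum]

theorem rotHess_add (f g : A) (a b : Fin 3) :
    S.rotHess (f + g) a b = S.rotHess f a b + S.rotHess g a b := by
  simp only [rotHess, hess_add, ← Finset.sum_add_distrib]
  exact Finset.sum_congr rfl fun e _ => by ring

theorem rotHess_smul (r : ℝ) (f : A) (a b : Fin 3) :
    S.rotHess (r • f) a b = r • S.rotHess f a b := by
  simp only [rotHess, hess_smul, mul_smul_comm, ← smul_add, ← Finset.smul_sum]

theorem hessTF_one (a b : Fin 3) : S.hessTF 1 a b = 0 := by
  simp [hessTF, hess, lap]

theorem hessTF_x (k a b : Fin 3) : S.hessTF (S.x k) a b = 0 := by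
  rw [hessTF, hess, lap, sum_D_D_x, D_D_x]
  ring

/-- The projection to the modes `ℓ ≤ 1`. -/
def lowModes (f : A) : A :=
  ((4 * Real.pi)⁻¹ * S.int f) • (1 : A) + ∑ i, (3 / (4 * Real.pi) * S.int (f * S.x i)) • S.x i

theorem hessTF_lowModes (f : A) (a b : Fin 3) : S.hessTF (S.lowModes f) a b = 0 := by
  simp only [lowModes, Fin.sum_univ_three, hessTF_add, hessTF_smul, hessTF_one, hessTF_x,
    smul_zero, add_zero]

theorem int_x (a : Fin 3) : S.int (S.x a) = 0 := by
  have := S.int_D a 1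
  simp only [Derivation.map_one_eq_zero, map_zero, mul_one] at this
  linarith

/-- Integrating `D a (x b)` in two ways gives `3∫ x_a x_b = 4π δ_{ab}`, with no coordinates on the
sphere. -/
theorem int_x_mul_x (a b : Fin 3) :
    S.int (S.x a * S.x b) = if a = b then 4 * Real.pi / 3 else 0 := by
  have := S.int_D a (S.x b)
  rw [D_x, map_sub] at this
  split_ifs at this ⊢
  · rw [int_one] at this
    linarith
  · rw [map_zero] at this
    linarith

theorem int_lowModes (f : A) : S.int (S.lowModes f) = S.int f := by
  have := Real.pi_ne_zero
  simp only [lowModes, Fin.sum_univ_three, map_add, map_smul, int_x, int_one, smul_eq_mul]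
  field_simp
  ring

theorem int_lowModes_mul_x (f : A) (i : Fin 3) :
    S.int (S.lowModes f * S.x i) = S.int (f * S.x i) := by
  have := Real.pi_ne_zero
  simp only [lowModes, Fin.sum_univ_three, add_mul, smul_mul_assoc, one_mul, map_add, map_smul,
    int_x, int_x_mul_x, smul_eq_mul]
  fin_cases i <;> simp <;> field_simp

/-- The shear changes by `-hessTF f`, so `c` must change by `-2f` modulo the kernel of `hessTF`.
Subtracting the low modes, which lie in that kernel, restores orthogonality to `ℓ ≤ 1`; uniqueness
of potentials does the rest. -/
theorem potentials_shift {c cb c' cb' f : A}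
    (h : ∀ a b, S.hessTF c' a b + S.rotHess cb' a b =
      S.hessTF c a b + S.rotHess cb a b + 2 * S.shearShift f a b)
    (hc : S.int c = 0) (hcx : ∀ i, S.int (c * S.x i) = 0)
    (hcb : S.int cb = 0) (hcbx : ∀ i, S.int (cb * S.x i) = 0)
    (hc' : S.int c' = 0) (hcx' : ∀ i, S.int (c' * S.x i) = 0)
    (hcb' : S.int cb' = 0) (hcbx' : ∀ i, S.int (cb' * S.x i) = 0) :
    c' = c - 2 * (f - S.lowModes f) ∧ cb' = cb := by
  have key := S.potentials_eq_zero
    (d := c' + (-1 : ℝ) • c + (2 : ℝ) • (f + (-1 : ℝ) • S.lowModes f))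
    (e := cb' + (-1 : ℝ) • cb) ?_ ?_ ?_ ?_ ?_
  · refine ⟨?_, ?_⟩
    · have := key.1
      simp only [Algebra.smul_def, map_neg, map_ofNat, map_one] at this
      linear_combination this
    · have := key.2
      simp only [neg_smul, one_smul] at this
      linear_combination this
  · intro a b
    have := h a b
    simp only [shearShift] at this
    simp only [hessTF_add, hessTF_smul, rotHess_add, rotHess_smul, hessTF_lowModes]
    simp only [Algebra.smul_def, map_neg, map_ofNat, map_one]
    linear_combination this
  · simp [hc, hc', int_lowModes]
  · intro i
    simp [add_mul, hcx, hcx', int_lowModes_mul_x]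
  · simp [hcb, hcb']
  · intro i
    simp [add_mul, hcbx, hcbx']

/-! ### The charges in the abstract calculus and their change -/

/-- The integrated contraction of two covector fields. -/
def pair (V : Fin 3 → A) : (Fin 3 → A) →ₗ[ℝ] ℝ :=
  S.int ∘ₗ ∑ a, LinearMap.mulLeft ℝ (V a) ∘ₗ LinearMap.proj a

theorem pair_apply (V w : Fin 3 → A) : S.pair V w = S.int (∑ a, V a * w a) := by
  simp [pair]

/-- The gradient as a covector field. -/
def gradient (f : A) : Fin 3 → A := fun a => S.D a f

theorem pair_gradient {V : Fin 3 → A} (hV : ∑ a, S.x a * V a = 0) (f : A) :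
    S.pair V (S.gradient f) = - S.int (f * ∑ a, S.D a (V a)) := by
  rw [pair_apply]
  exact S.int_sum_mul_D hV f

/-- The rotation fields. -/
def rot (k a : Fin 3) : A := ∑ b, S.eps a b * S.D b (S.x k)

theorem rot_eq (k a : Fin 3) : S.rot k a = S.eps a k := by
  have h := S.sum_eps_mul_x a
  simp only [rot, S.D_x, Fin.sum_univ_three] at *
  fin_cases k <;> simp
  · linear_combination (- S.x 0) * h
  · linear_combination (- S.x 1) * h
  · linear_combination (- S.x 2) * h

theorem exists_rot_eq (k : Fin 3) : ∃ E : Fin 3 → Fin 3 → A, (∀ c a b, S.D c (E a b) = 0) ∧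
    (∀ a b, E a b = - E b a) ∧ ∀ a, S.rot k a = ∑ c, E a c * S.x c := by
  -- The matrices of `v ↦ e_k × v`, the generators of the rotations.
  refine ⟨fun a c => (![!![0, 0, 0; 0, 0, -1; 0, 1, 0], !![0, 0, 1; 0, 0, 0; -1, 0, 0],
    !![0, -1, 0; 1, 0, 0; 0, 0, 0]] : Fin 3 → Matrix (Fin 3) (Fin 3) A) k a c, ?_, ?_, ?_⟩
  · intro c a b
    fin_cases k <;> fin_cases a <;> fin_cases b <;> simp
  · intro a b
    fin_cases k <;> fin_cases a <;> fin_cases b <;> simp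
  · intro a
    rw [rot_eq, eps]
    fin_cases k <;> fin_cases a <;> simp [Fin.sum_univ_three]

/-- The covector field `C_{AB} ∇_D C^{DB}`. -/
def quad (C : Fin 3 → Fin 3 → A) (a : Fin 3) : A := ∑ b, C a b * S.dvg C b

/-- The squared norm of a 2-tensor. -/
def normSq (C : Fin 3 → Fin 3 → A) : A := ∑ a, ∑ b, C a b * C a b

theorem shearShift_one : S.shearShift 1 = 0 := by
  ext a b
  simp [shearShift, hessTF_one]

theorem dvg_zero : S.dvg (0 : Fin 3 → Fin 3 → A) = 0 := by
  ext b
  simp [dvg]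

/-- The constant `f = 1` is a time translation; the integral lemmas at `f = 1` thereby control the
part of `N` that grows linearly in `u`. -/
theorem shearDensity_one (C : Fin 3 → Fin 3 → A) :
    S.shearDensity C 1 = S.dvg (S.curl (S.dvg C)) := by
  ext a
  simp [shearDensity, shearShift_one, dvg_zero]

theorem dvg_add (C H : Fin 3 → Fin 3 → A) : S.dvg (C + H) = S.dvg C + S.dvg H := by
  ext b
  simp [dvg, Finset.sum_add_distrib]

/-- The transformation law of the angular momentum aspect for vanishing news, combined with the
evolution by the retarded time `s`. -/
def aspectShift (m : A) (C : Fin 3 → Fin 3 → A) (s : ℝ) (f : A) : Fin 3 → A :=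
  s • S.gradient m + (fun a => f * S.D a m + 3 * m * S.D a f)
    - (1 / 4 : ℝ) • (s • S.dvg (S.curl (S.dvg C))
      + fun a => f * S.dvg (S.curl (S.dvg C)) a + 3 * ∑ b, S.curl (S.dvg C) b a * S.D b f)

/-- The hypothesis `h1` removes the part of the shear contribution proportional to `s`; adding and
subtracting the quadratic terms completes the rest to `shearDensity`. -/
theorem pair_aspectShift {V : Fin 3 → A} (m : A) (C : Fin 3 → Fin 3 → A) (s : ℝ) (f : A)
    (h1 : S.pair V (S.shearDensity C 1) = 0) :
    S.pair V (S.aspectShift m C s f) = s * S.pair V (S.gradient m)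
      + S.pair V (fun a => f * S.D a m + 3 * m * S.D a f)
      - 1 / 4 * (S.pair V (S.shearDensity C f)
        - S.pair V (S.quad (C + S.shearShift f)) + S.pair V (S.quad C)) := by
  rw [shearDensity_one] at h1
  have e : S.shearDensity C f = (fun a => f * S.dvg (S.curl (S.dvg C)) a
      + 3 * ∑ b, S.curl (S.dvg C) b a * S.D b f) + S.quad (C + S.shearShift f) - S.quad C := by
    ext a
    simp only [shearDensity, quad, dvg_add, Pi.add_apply, Pi.sub_apply]
    ring
  rw [e, aspectShift]
  simp only [map_add, map_sub, map_smul, smul_eq_mul, h1]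
  ring

/-- The angular momentum. -/
def angularMomentum (m : A) (N : Fin 3 → A) (C : Fin 3 → Fin 3 → A) (c : A) (k : Fin 3) : ℝ :=
  S.pair (S.rot k) N - 1 / 4 * S.pair (S.rot k) (S.quad C)
    - S.pair (S.rot k) (fun a => c * S.D a m)

/-- Rotation fields are divergence-free, so gradients and shear densities pair to zero. The terms
`-2f∇m` from `N` and `+2f∇m` from the new potential cancel, leaving `-2l∇m`. -/
theorem angularMomentum_shift {C : Fin 3 → Fin 3 → A} (hC : IsSTT S C) (m : A) (N : Fin 3 → A)
    (c f l : A) (s : ℝ) (k : Fin 3) :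
    S.angularMomentum m (N + S.aspectShift m C s f) (C + S.shearShift f) (c - 2 * (f - l)) k
      - S.angularMomentum m N C c k = -2 * S.pair (S.rot k) (fun a => l * S.D a m) := by
  obtain ⟨E, hE, hEs, hY⟩ := S.exists_rot_eq k
  have hxY := S.sum_x_mul_rotation hEs hY
  have hdY : ∑ a, S.D a (S.rot k a) = 0 := by
    simp only [rot_eq, sum_D_eps]
  have h0 : ∀ f, S.pair (S.rot k) (S.shearDensity C f) = 0 := fun f => by
    rw [pair_apply]
    exact S.int_rotation_mul_shearDensity hE hEs hY hC f
  have hg : ∀ g, S.pair (S.rot k) (S.gradient g) = 0 := fun g => by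
    rw [S.pair_gradient hxY, hdY, mul_zero, map_zero, neg_zero]
  have e1 : (fun a => (c - 2 * (f - l)) * S.D a m) = (fun a => c * S.D a m)
      + (-2 : ℝ) • (fun a => f * S.D a m) + (2 : ℝ) • (fun a => l * S.D a m) := by
    ext a
    simp only [Pi.add_apply, Pi.smul_apply]
    simp only [Algebra.smul_def, map_neg, map_ofNat]
    ring
  have e2 : (fun a => f * S.D a m + 3 * m * S.D a f) = (3 : ℝ) • S.gradient (f * m)
      + (-2 : ℝ) • (fun a => f * S.D a m) := by
    ext a
    simp only [gradient, Pi.add_apply, Pi.smul_apply, Derivation.leibniz, smul_eq_mul]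
    simp only [Algebra.smul_def, map_neg, map_ofNat]
    ring
  simp only [angularMomentum, map_add, S.pair_aspectShift m C s f (h0 1), h0, hg, e1, e2,
    map_smul, smul_eq_mul]
  ring

/-- The center of mass. -/
def centerOfMass (u : ℝ) (m : A) (N : Fin 3 → A) (C : Fin 3 → Fin 3 → A) (c cb : A)
    (k : Fin 3) : ℝ :=
  S.pair (S.gradient (S.x k)) N - u * S.pair (S.gradient (S.x k)) (S.gradient m)
    - 1 / 4 * S.pair (S.gradient (S.x k)) (S.quad C)
    - 1 / 16 * S.pair (S.gradient (S.x k)) (S.gradient (normSq C))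
    - S.pair (S.gradient (S.x k)) (fun a => c * S.D a m)
    + 2 * S.pair (S.gradient (S.x k)) (fun a => (∑ b, S.eps a b * S.D b cb) * m)
    + 3 * S.int (S.x k * c * m)
    - 1 / 4 * S.int (S.x k * ∑ b, S.dvg (fun a b => (1 / 2 : ℝ) • S.rotHess cb a b) b *
        S.dvg (fun a b => (1 / 2 : ℝ) • S.rotHess cb a b) b)

/-- The explicit `-u∇m` compensates the drift `(u' - u)∇m` of `N`. The gradient `3∇(fm)` gives
`6∫X^k f m`, and the new potential in `3X^k c m` gives `-6∫X^k (f - l) m`. -/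
theorem centerOfMass_shift {C : Fin 3 → Fin 3 → A} (hC : IsSTT S C) (m : A) (N : Fin 3 → A)
    (c cb f l : A) (u u' : ℝ) (k : Fin 3) :
    S.centerOfMass u' m (N + S.aspectShift m C (u' - u) f) (C + S.shearShift f)
        (c - 2 * (f - l)) cb k - S.centerOfMass u m N C c cb k =
      6 * S.int (l * S.x k * m) - 2 * S.pair (S.gradient (S.x k)) (fun a => l * S.D a m) := by
  have hxZ : ∑ a, S.x a * S.gradient (S.x k) a = 0 := S.sum_x_mul_D (S.x k)
  have h0 : ∀ f, 2 * S.pair (S.gradient (S.x k)) (S.shearDensity C f) +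
      (S.int (S.x k * normSq (C + S.shearShift f)) - S.int (S.x k * normSq C)) = 0 := by
    intro f
    rw [← S.int_conformal_mul_shearDensity hC f k, pair_apply, ← map_sub, ← mul_sub]
    simp only [normSq, ← Finset.sum_sub_distrib]
    rfl
  have h1 : S.pair (S.gradient (S.x k)) (S.shearDensity C 1) = 0 := by
    have := h0 1
    rw [shearShift_one, add_zero, sub_self] at this
    linarith
  have hg : ∀ g, S.pair (S.gradient (S.x k)) (S.gradient g) = 2 * S.int (S.x k * g) := by
    intro g
    rw [S.pair_gradient hxZ]
    simp only [gradient]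
    rw [sum_D_D_x, mul_neg, map_neg, neg_neg, ← mul_assoc, mul_comm g, mul_assoc, two_mul,
      map_add, two_mul, mul_comm g]
  have e1 : (fun a => (c - 2 * (f - l)) * S.D a m) = (fun a => c * S.D a m)
      + (-2 : ℝ) • (fun a => f * S.D a m) + (2 : ℝ) • (fun a => l * S.D a m) := by
    ext a
    simp only [Pi.add_apply, Pi.smul_apply]
    simp only [Algebra.smul_def, map_neg, map_ofNat]
    ring
  have e2 : (fun a => f * S.D a m + 3 * m * S.D a f) = (3 : ℝ) • S.gradient (f * m)
      + (-2 : ℝ) • (fun a => f * S.D a m) := by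
    ext a
    simp only [gradient, Pi.add_apply, Pi.smul_apply, Derivation.leibniz, smul_eq_mul]
    simp only [Algebra.smul_def, map_neg, map_ofNat]
    ring
  have e3 : S.x k * (c - 2 * (f - l)) * m = S.x k * c * m + (-2 : ℝ) • (S.x k * (f * m))
      + (2 : ℝ) • (l * S.x k * m) := by
    simp only [Algebra.smul_def, map_neg, map_ofNat]
    ring
  have h2 := h0 f
  have h3 := hg (normSq (C + S.shearShift f))
  have h4 := hg (normSq C)
  have h5 := hg (f * m)
  simp only [centerOfMass, map_add, S.pair_aspectShift m C (u' - u) f h1, e1, e2, e3,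
    map_smul, smul_eq_mul]
  linear_combination (-1 / 8) * h2 - 1 / 16 * h3 + 1 / 16 * h4 + 3 * h5

end TangentialCalculus

-- Gradients on the actual sphere through radial extensions

local notation "E3" => EuclideanSpace ℝ (Fin 3)

theorem S2.ne_zero (x : S2) : (x : E3) ≠ 0 := by
  intro h
  have := x.2
  rw [h] at this
  simp at this

theorem S2.norm_eq (x : S2) : ‖(x : E3)‖ = 1 := by simp

theorem radialExt_apply (f : S2 → ℝ) {y : E3} (hy : y ≠ 0) :
    radialExt f y = f ⟨‖y‖⁻¹ • y, normalize_mem hy⟩ := dif_pos hy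

theorem radialExt_coe (f : S2 → ℝ) (x : S2) : radialExt f x = f x := by
  rw [radialExt_apply f x.ne_zero]
  congr 1
  ext1
  simp [x.norm_eq]

theorem radialExt_smul (f : S2 → ℝ) {r : ℝ} (hr : 0 < r) (y : E3) :
    radialExt f (r • y) = radialExt f y := by
  by_cases hy : y = 0
  · simp [hy]
  · rw [radialExt_apply f hy, radialExt_apply f (smul_ne_zero hr.ne' hy)]
    congr 1
    ext1
    simp only [norm_smul, Real.norm_eq_abs, abs_of_pos hr, smul_smul]
    congr 1
    field_simp

theorem SmoothFn.contDiffAt_radialExt {f : S2 → ℝ} (hf : SmoothFn f) {y : E3} (hy : y ≠ 0) :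
    ContDiffAt ℝ ∞ (radialExt f) y := by
  -- On the punctured space, as an open submanifold, normalisation is a globally defined smooth map
  -- into the sphere, which can be composed with `f`.
  let U : TopologicalSpace.Opens E3 := ⟨{0}ᶜ, isOpen_compl_singleton⟩
  have hmem : ∀ z : U, ‖(z : E3)‖⁻¹ • (z : E3) ∈ Metric.sphere (0 : E3) 1 :=
    fun z => normalize_mem z.2
  have h1 : ContMDiff 𝓘(ℝ, E3) 𝓘(ℝ, E3) ∞ (fun z : U => ‖(z : E3)‖⁻¹ • (z : E3)) := by
    intro z
    refine (contMDiffAt_subtype_iff (f := fun w : E3 => ‖w‖⁻¹ • w)).2 ?_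
    rw [contMDiffAt_iff_contDiffAt]
    exact ((contDiffAt_norm ℝ z.2).inv (norm_ne_zero_iff.2 z.2)).smul contDiffAt_id
  have : Fact (Module.finrank ℝ E3 = 2 + 1) := ⟨finrank_euclideanSpace_fin⟩
  have h2 := hf.comp (ContMDiff.codRestrict_sphere (n := 2) h1 hmem)
  rw [← contMDiffAt_iff_contDiffAt]
  refine (contMDiffAt_subtype_iff (U := U) (x := ⟨y, hy⟩)).1 ?_
  refine (h2 ⟨y, hy⟩).congr_of_eventuallyEq (Filter.Eventually.of_forall fun z => ?_)
  exact radialExt_apply f z.2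

theorem smoothFn_of_contDiffAt {F : E3 → ℝ} (hF : ∀ x : S2, ContDiffAt ℝ ∞ F x) :
    SmoothFn (fun x : S2 => F x) := fun x =>
  haveI : Fact (Module.finrank ℝ E3 = 2 + 1) := ⟨finrank_euclideanSpace_fin⟩
  ContMDiffAt.comp x (contMDiffAt_iff_contDiffAt.2 (hF x)) (contMDiff_coe_sphere (n := 2) x)

theorem SmoothFn.contDiffAt_fderiv {f : S2 → ℝ} (hf : SmoothFn f) {y : E3} (hy : y ≠ 0) (v : E3) :
    ContDiffAt ℝ ∞ (fun z => fderiv ℝ (radialExt f) z v) y :=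
  ((hf.contDiffAt_radialExt hy).fderiv_right (m := ∞) (by simp)).clm_apply contDiffAt_const

theorem SmoothFn.grad {f : S2 → ℝ} (hf : SmoothFn f) (a : Fin 3) :
    SmoothFn (fun x => grad f x a) :=
  smoothFn_of_contDiffAt fun x => hf.contDiffAt_fderiv x.ne_zero _

theorem smoothFn_coord (k : Fin 3) : SmoothFn (coord k) :=
  smoothFn_of_contDiffAt (F := fun y : E3 => y k) fun x => by fun_prop

theorem SmoothFn.differentiableAt {f : S2 → ℝ} (hf : SmoothFn f) {y : E3} (hy : y ≠ 0) :
    DifferentiableAt ℝ (radialExt f) y :=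
  (hf.contDiffAt_radialExt hy).differentiableAt (by simp)

theorem radialExt_add (f g : S2 → ℝ) : radialExt (f + g) = radialExt f + radialExt g := by
  ext y
  by_cases hy : y = 0 <;> simp [radialExt, hy]

theorem radialExt_const_smul (r : ℝ) (f : S2 → ℝ) : radialExt (r • f) = r • radialExt f := by
  ext y
  by_cases hy : y = 0 <;> simp [radialExt, hy]

theorem radialExt_mul (f g : S2 → ℝ) : radialExt (f * g) = radialExt f * radialExt g := by
  ext y
  by_cases hy : y = 0 <;> simp [radialExt, hy]

theorem grad_add {f g : S2 → ℝ} (hf : SmoothFn f) (hg : SmoothFn g) (x : S2) (a : Fin 3) :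
    grad (f + g) x a = grad f x a + grad g x a := by
  rw [grad, radialExt_add, fderiv_add (hf.differentiableAt x.ne_zero)
    (hg.differentiableAt x.ne_zero)]
  rfl

theorem grad_const_smul {f : S2 → ℝ} (hf : SmoothFn f) (r : ℝ) (x : S2) (a : Fin 3) :
    grad (r • f) x a = r * grad f x a := by
  rw [grad, radialExt_const_smul, fderiv_const_smul (hf.differentiableAt x.ne_zero)]
  rfl

theorem grad_mul {f g : S2 → ℝ} (hf : SmoothFn f) (hg : SmoothFn g) (x : S2) (a : Fin 3) :
    grad (f * g) x a = f x * grad g x a + g x * grad f x a := by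
  rw [grad, radialExt_mul, fderiv_mul (hf.differentiableAt x.ne_zero)
    (hg.differentiableAt x.ne_zero), radialExt_coe, radialExt_coe]
  rfl

theorem fderiv_radialExt_smul (f : S2 → ℝ) {r : ℝ} (hr : 0 < r) (y v : E3) :
    fderiv ℝ (radialExt f) (r • y) v = r⁻¹ * fderiv ℝ (radialExt f) y v := by
  have h := fderiv_comp_smul (𝕜 := ℝ) (f := radialExt f) (x := y) r
  simp only [radialExt_smul f hr] at h
  rw [show (fun x => radialExt f x) = radialExt f from rfl] at h
  rw [h]
  simp [hr.ne']

theorem fderiv_radialExt_self (f : S2 → ℝ) (x : S2) (hf : SmoothFn f) :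
    fderiv ℝ (radialExt f) x (x : E3) = 0 := by
  have h1 : HasDerivAt (fun t : ℝ => (t • (x : E3))) (x : E3) 1 := by
    simpa using (hasDerivAt_id (1 : ℝ)).smul_const (x : E3)
  have h2 : HasFDerivAt (radialExt f) (fderiv ℝ (radialExt f) x) ((1 : ℝ) • (x : E3)) := by
    rw [one_smul]
    exact (hf.differentiableAt x.ne_zero).hasFDerivAt
  have h3 := h2.comp_hasDerivAt (1 : ℝ) h1
  have h4 : HasDerivAt (radialExt f ∘ fun t : ℝ => (t • (x : E3))) 0 1 := by
    refine (hasDerivAt_const (1 : ℝ) (radialExt f x)).congr_of_eventuallyEq ?_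
    filter_upwards [lt_mem_nhds (zero_lt_one (α := ℝ))] with t ht
    exact radialExt_smul f ht _
  exact h3.unique h4

theorem eq_sum_single (y : E3) : y = ∑ a, y a • EuclideanSpace.single a (1 : ℝ) := by
  ext b
  simp [Finset.sum_apply, Pi.single_apply]

theorem sum_coord_mul_grad {f : S2 → ℝ} (hf : SmoothFn f) (x : S2) :
    ∑ a, coord a x * grad f x a = 0 := by
  rw [← fderiv_radialExt_self f x hf]
  have h := congrArg (fderiv ℝ (radialExt f) x) (eq_sum_single (x : E3))
  rw [h]
  simp [grad, coord]

theorem hasFDerivAt_norm_sphere (x : S2) :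
    HasFDerivAt (fun y : E3 => ‖y‖) (innerSL ℝ (x : E3)) x := by
  have h := ((hasStrictFDerivAt_norm_sq (x : E3)).hasFDerivAt).sqrt (by simp [x.norm_eq])
  simp only [Real.sqrt_sq (norm_nonneg _), x.norm_eq] at h
  convert! h using 1
  ext v
  simp

theorem grad_coord (k : Fin 3) (x : S2) (a : Fin 3) :
    grad (coord k) x a = (if a = k then 1 else 0) - coord a x * coord k x := by
  have h1 : HasFDerivAt (fun y : E3 => ‖y‖⁻¹ * y k)
      (‖(x : E3)‖⁻¹ • (EuclideanSpace.proj k : E3 →L[ℝ] ℝ) +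
        (x : E3) k • (-(‖(x : E3)‖ ^ 2)⁻¹) • innerSL ℝ (x : E3)) x :=
    ((hasDerivAt_inv (by simp [x.norm_eq])).comp_hasFDerivAt (x : E3)
      (hasFDerivAt_norm_sphere x)).mul (EuclideanSpace.proj k : E3 →L[ℝ] ℝ).hasFDerivAt
  have h2 : radialExt (coord k) =ᶠ[nhds (x : E3)] fun y : E3 => ‖y‖⁻¹ * y k := by
    filter_upwards [isOpen_ne.mem_nhds x.ne_zero] with y hy
    rw [radialExt_apply _ hy]
    simp [coord]
  rw [grad, h2.fderiv_eq, h1.fderiv]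
  simp [x.norm_eq, coord, EuclideanSpace.inner_single_right, mul_comm, eq_comm]
  ring

/-- The gradient of a function homogeneous of degree `0` has degree `-1`; the factor `‖y‖` restores
degree `0`. Differentiating this factor produces the first-order terms in the commutator
`grad_comm`. -/
theorem radialExt_grad {f : S2 → ℝ} (b : Fin 3) {y : E3} (hy : y ≠ 0) :
    radialExt (fun x => grad f x b) y =
      ‖y‖ * fderiv ℝ (radialExt f) y (EuclideanSpace.single b 1) := by
  rw [radialExt_apply _ hy, grad]
  simp only
  rw [fderiv_radialExt_smul f (inv_pos.2 (norm_pos_iff.2 hy)), inv_inv]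

theorem grad_grad {f : S2 → ℝ} (hf : SmoothFn f) (x : S2) (a b : Fin 3) :
    grad (fun x => grad f x b) x a = coord a x * grad f x b +
      fderiv ℝ (fderiv ℝ (radialExt f)) x (EuclideanSpace.single a 1)
        (EuclideanSpace.single b 1) := by
  have h2 : radialExt (fun x => grad f x b) =ᶠ[nhds (x : E3)]
      fun y : E3 => ‖y‖ * fderiv ℝ (radialExt f) y (EuclideanSpace.single b 1) := by
    filter_upwards [isOpen_ne.mem_nhds x.ne_zero] with y hy
    exact radialExt_grad b hy
  have h3 : DifferentiableAt ℝ (fderiv ℝ (radialExt f)) x :=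
    ((hf.contDiffAt_radialExt x.ne_zero).fderiv_right (m := ∞) (by simp)).differentiableAt (by simp)
  have h4 := (hasFDerivAt_norm_sphere x).mul
    (h3.hasFDerivAt.clm_apply (hasFDerivAt_const (EuclideanSpace.single b (1 : ℝ)) (x : E3)))
  conv_lhs => rw [grad, h2.fderiv_eq]
  refine (congrArg (fun L => L (EuclideanSpace.single a 1)) h4.fderiv).trans ?_
  simp [x.norm_eq, coord, grad, EuclideanSpace.inner_single_right]
  ring

theorem grad_comm {f : S2 → ℝ} (hf : SmoothFn f) (x : S2) (a b : Fin 3) :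
    grad (fun x => grad f x b) x a = grad (fun x => grad f x a) x b +
      coord a x * grad f x b - coord b x * grad f x a := by
  have h := (hf.contDiffAt_radialExt x.ne_zero).isSymmSndFDerivAt (by
    rw [minSmoothness_of_isRCLikeNormedField]
    exact WithTop.coe_le_coe.2 (le_top : (2 : ℕ∞) ≤ ⊤))
  rw [grad_grad hf, grad_grad hf, h.eq]
  ring

theorem exists_eq_const_of_grad_eq_zero {f : S2 → ℝ} (hf : SmoothFn f)
    (h : ∀ x a, grad f x a = 0) : ∃ r, ∀ x, f x = r := by
  -- In dimension greater than one the punctured space is connected, so a radial extension with zero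
  -- derivative there is constant.
  have hrank : 1 < Module.rank ℝ E3 := by
    rw [← Module.finrank_eq_rank, finrank_euclideanSpace_fin]
    norm_num
  obtain ⟨r, hr⟩ := (isOpen_compl_singleton (x := (0 : E3))).exists_is_const_of_fderiv_eq_zero
    (𝕜 := ℝ) (f := radialExt f)
    (isConnected_compl_singleton_of_one_lt_rank hrank 0).isPreconnected
    (fun y hy => (hf.differentiableAt hy).differentiableWithinAt) (fun y hy => by
      ext v
      have hy0 : ‖y‖ ≠ 0 := norm_ne_zero_iff.2 hy
      have hsingle : ∀ b, fderiv ℝ (radialExt f) y (EuclideanSpace.single b 1) = 0 := by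
        intro b
        have h1 := radialExt_grad (f := f) b hy
        rw [radialExt_apply _ hy, h] at h1
        simpa [hy0] using h1.symm
      rw [eq_sum_single v, map_sum]
      simp [hsingle])
  exact ⟨r, fun x => by rw [← hr x x.ne_zero, radialExt_coe]⟩

/-! ### Integration on the sphere -/

instance : IsFiniteMeasure area := by unfold area; infer_instance

instance : area.IsOpenPosMeasure := by unfold area; infer_instance

/-- Polar coordinates with Jacobian `r²`; integrals of products over product measures split without
any integrability assumption. -/
theorem integral_norm_mul_radialExt (h : ℝ → ℝ) (g : S2 → ℝ) :
    ∫ y : E3, h ‖y‖ * radialExt g y =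
      (∫ r in Set.Ioi (0 : ℝ), r ^ 2 * h r) * ∫ x, g x ∂area := by
  have hd : Module.finrank ℝ E3 - 1 = 2 := by simp
  calc
    ∫ y : E3, h ‖y‖ * radialExt g y
      = ∫ y : ({(0)}ᶜ : Set E3), h ‖y.1‖ * radialExt g y
          ∂((volume : Measure E3).comap (↑)) := by
      rw [integral_subtype_comap (measurableSet_singleton _).compl
        fun y => h ‖y‖ * radialExt g y, restrict_compl_singleton]
    _ = ∫ p, g p.1 * h p.2 ∂area.prod (.volumeIoiPow (Module.finrank ℝ E3 - 1)) := by
      rw [area, ← (Measure.measurePreserving_homeomorphUnitSphereProd volume).integral_comp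
        (Homeomorph.measurableEmbedding _)]
      refine integral_congr_ae (Filter.Eventually.of_forall fun y => ?_)
      simp only [homeomorphUnitSphereProd_apply_snd_coe]
      rw [radialExt_apply g y.2, mul_comm]
      congr 2
      exact Subtype.ext (homeomorphUnitSphereProd_apply_fst_coe _ _).symm
    _ = (∫ x, g x ∂area) * ∫ r : Set.Ioi (0 : ℝ), h r ∂.volumeIoiPow (Module.finrank ℝ E3 - 1) :=
      integral_prod_mul (fun x => g x) (fun r : Set.Ioi (0 : ℝ) => h r)
    _ = _ := by
      rw [mul_comm, hd]
      congr 1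
      simp only [Measure.volumeIoiPow, ENNReal.ofReal]
      rw [integral_withDensity_eq_integral_smul,
        integral_subtype_comap measurableSet_Ioi fun a => Real.toNNReal (a ^ 2) • h a]
      · refine setIntegral_congr_fun measurableSet_Ioi fun r hr => ?_
        simp only [NNReal.smul_def, Real.coe_toNNReal _ (sq_nonneg r), smul_eq_mul]
      · exact (measurable_subtype_coe.pow_const _).real_toNNReal

theorem integrable_mul_of_zero_notMem_tsupport {g F : E3 → ℝ} (hg : Continuous g)
    (hc : HasCompactSupport g) (h0 : (0 : E3) ∉ tsupport g) (hF : ContinuousOn F {0}ᶜ) :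
    Integrable (fun y => g y * F y) := by
  have hsub : tsupport (fun y => g y * F y) ⊆ tsupport g := tsupport_mul_subset_left
  refine Continuous.integrable_of_hasCompactSupport ?_ hc.mul_right
  refine (hg.continuousOn.mul hF).continuous_of_tsupport_subset isOpen_compl_singleton ?_
  intro y hy hy0
  exact h0 (hy0 ▸ hsub hy)

theorem SmoothFn.continuous {f : S2 → ℝ} (hf : SmoothFn f) : Continuous f :=
  ContMDiff.continuous hf

theorem SmoothFn.integrable {f : S2 → ℝ} (hf : SmoothFn f) : Integrable f area :=
  hf.continuous.integrable_of_hasCompactSupport (HasCompactSupport.of_compactSpace f)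

/-- Integrate `∂_a` by parts in `ℝ³` against a radial cutoff. Polar coordinates split both sides
into a radial factor and a spherical integral, and the factor `2` comes from comparing the two
radial factors. -/
theorem integral_grad {f : S2 → ℝ} (hf : SmoothFn f) (a : Fin 3) :
    ∫ x, grad f x a ∂area = 2 * ∫ x, coord a x * f x ∂area := by
  -- Composed with `‖y‖²`, this bump is supported in `1 ≤ ‖y‖² ≤ 3`, away from the origin, where
  -- radial extensions are singular.
  let χ : ContDiffBump (2 : ℝ) := ⟨1 / 2, 1, by norm_num, by norm_num⟩
  set ψ : E3 → ℝ := fun y => χ (‖y‖ ^ 2) with hψ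
  have hψs : ContDiff ℝ ∞ ψ := χ.contDiff.comp (contDiff_norm_sq ℝ)
  have hts : tsupport ψ ⊆ (fun y : E3 => ‖y‖ ^ 2) ⁻¹' Metric.closedBall 2 1 := by
    rw [← χ.tsupport_eq]
    exact tsupport_comp_subset_preimage χ (by fun_prop)
  have h0 : (0 : E3) ∉ tsupport ψ := by
    intro h
    have := hts h
    simp [Real.dist_eq] at this
  have hc : HasCompactSupport ψ := by
    refine HasCompactSupport.of_support_subset_isCompact
      (isCompact_closedBall (0 : E3) 2) (subset_closure.trans (hts.trans ?_))
    intro y hy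
    simp only [Set.mem_preimage, Metric.mem_closedBall, Real.dist_eq, dist_zero_right] at hy ⊢
    have := (abs_le.1 hy).2
    nlinarith [norm_nonneg y]
  have hdψ : ∀ y, fderiv ℝ ψ y (EuclideanSpace.single a 1) =
      deriv χ (‖y‖ ^ 2) * (2 * y a) := by
    intro y
    have h1 : HasDerivAt χ (deriv χ (‖y‖ ^ 2)) (‖y‖ ^ 2) :=
      ((χ.contDiff (n := 1)).differentiable (by simp) _).hasDerivAt
    have h2 := h1.comp_hasFDerivAt y (hasStrictFDerivAt_norm_sq y).hasFDerivAt
    rw [hψ]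
    refine (congrArg (fun L => L (EuclideanSpace.single a 1)) h2.fderiv).trans ?_
    simp [EuclideanSpace.inner_single_right]
  set v : E3 := EuclideanSpace.single a 1 with hv
  have hF : ContinuousOn (radialExt f) {0}ᶜ := fun y hy =>
    (hf.contDiffAt_radialExt hy).continuousAt.continuousWithinAt
  have hF' : ContinuousOn (fun y => fderiv ℝ (radialExt f) y v) {0}ᶜ := fun y hy =>
    (hf.contDiffAt_fderiv hy v).continuousAt.continuousWithinAt
  have hψ' : Continuous (fun y => fderiv ℝ ψ y v) :=
    (hψs.continuous_fderiv (by simp)).clm_apply continuous_const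
  have hc' : HasCompactSupport (fun y => fderiv ℝ ψ y v) := hc.fderiv_apply ℝ v
  have h0' : (0 : E3) ∉ tsupport (fun y => fderiv ℝ ψ y v) := fun h =>
    h0 (tsupport_fderiv_apply_subset ℝ v h)
  have key := integral_mul_fderiv_eq_neg_fderiv_mul_of_integrable (μ := (volume : Measure E3))
    (f := ψ) (g := radialExt f) (v := v)
    (integrable_mul_of_zero_notMem_tsupport hψ' hc' h0' hF)
    (integrable_mul_of_zero_notMem_tsupport hψs.continuous hc h0 hF')
    (integrable_mul_of_zero_notMem_tsupport hψs.continuous hc h0 hF)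
    (fun y _ => hψs.differentiable (by simp) y)
    (fun y hy => hf.differentiableAt fun h => h0 (h ▸ hy))
  have e1 : ∫ y, ψ y * fderiv ℝ (radialExt f) y v =
      (∫ r in Set.Ioi (0 : ℝ), χ (r ^ 2) * r) * ∫ x, grad f x a ∂area := by
    have : ∀ r ∈ Set.Ioi (0 : ℝ), χ (r ^ 2) * r = r ^ 2 * (χ (r ^ 2) * r⁻¹) := by
      intro r hr
      have : r ≠ 0 := ne_of_gt hr
      field_simp
    rw [setIntegral_congr_fun measurableSet_Ioi this,
      ← integral_norm_mul_radialExt (fun r => χ (r ^ 2) * r⁻¹)]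
    refine integral_congr_ae ?_
    filter_upwards [Measure.ae_ne volume (0 : E3)] with y hy
    rw [radialExt_grad a hy, hψ, ← hv]
    have : ‖y‖ ≠ 0 := norm_ne_zero_iff.2 hy
    field_simp
  have e2 : ∫ y, fderiv ℝ ψ y v * radialExt f y =
      (∫ r in Set.Ioi (0 : ℝ), deriv χ (r ^ 2) * 2 * r ^ 3) * ∫ x, coord a x * f x ∂area := by
    have : ∀ r ∈ Set.Ioi (0 : ℝ), deriv χ (r ^ 2) * 2 * r ^ 3 =
        r ^ 2 * (deriv χ (r ^ 2) * 2 * r) := fun r _ => by ring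
    rw [setIntegral_congr_fun measurableSet_Ioi this,
      ← integral_norm_mul_radialExt (fun r => deriv χ (r ^ 2) * 2 * r)]
    refine integral_congr_ae ?_
    filter_upwards [Measure.ae_ne volume (0 : E3)] with y hy
    rw [radialExt_apply _ hy, radialExt_apply _ hy, hdψ]
    have : ‖y‖ ≠ 0 := norm_ne_zero_iff.2 hy
    simp only [coord, PiLp.smul_apply, smul_eq_mul]
    field_simp
  have hχd : ∀ r : ℝ, HasDerivAt (fun r => χ (r ^ 2) * r ^ 2)
      (deriv χ (r ^ 2) * 2 * r ^ 3 + 2 * (χ (r ^ 2) * r)) r := by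
    intro r
    have h1 : HasDerivAt χ (deriv χ (r ^ 2)) (r ^ 2) :=
      ((χ.contDiff (n := 1)).differentiable (by simp) _).hasDerivAt
    have hp : HasDerivAt (fun r : ℝ => r ^ 2) (2 * r) r := by simpa using hasDerivAt_pow 2 r
    have h2 := (HasDerivAt.comp (h := fun r : ℝ => r ^ 2) r h1 hp).mul hp
    convert! h2 using 1
    simp only [Function.comp_apply]
    ring
  have hχc : HasCompactSupport (fun r : ℝ => χ (r ^ 2)) := by
    refine HasCompactSupport.of_support_subset_isCompact
      (isCompact_closedBall (0 : ℝ) 2) ?_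
    intro r hr
    have : r ^ 2 ∈ Metric.closedBall (2 : ℝ) 1 := by
      rw [← χ.tsupport_eq]
      exact subset_closure hr
    simp only [Metric.mem_closedBall, Real.dist_eq, dist_zero_right, Real.norm_eq_abs] at this ⊢
    have := (abs_le.1 this).2
    exact abs_le_of_sq_le_sq (by linarith) (by norm_num)
  have hχ'c : HasCompactSupport (fun r : ℝ => deriv χ (r ^ 2)) := by
    refine HasCompactSupport.of_support_subset_isCompact
      (isCompact_closedBall (0 : ℝ) 2) ?_
    intro r hr
    have : r ^ 2 ∈ Metric.closedBall (2 : ℝ) 1 := by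
      rw [← χ.tsupport_eq]
      exact support_deriv_subset hr
    simp only [Metric.mem_closedBall, Real.dist_eq, dist_zero_right, Real.norm_eq_abs] at this ⊢
    have := (abs_le.1 this).2
    exact abs_le_of_sq_le_sq (by linarith) (by norm_num)
  have hχcont : Continuous χ := χ.continuous
  have hχ'cont : Continuous (deriv χ) := (χ.contDiff (n := 1)).continuous_deriv le_rfl
  have i1 : Integrable (fun r : ℝ => χ (r ^ 2) * r) :=
    Continuous.integrable_of_hasCompactSupport (by fun_prop) hχc.mul_right
  have i2 : Integrable (fun r : ℝ => deriv χ (r ^ 2) * 2 * r ^ 3) :=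
    Continuous.integrable_of_hasCompactSupport (by fun_prop) hχ'c.mul_right.mul_right
  -- The integrand is the derivative of `χ(r²) r²`, which vanishes at `0` and for large `r`.
  have hint : ∫ r in Set.Ioi (0 : ℝ), (deriv χ (r ^ 2) * 2 * r ^ 3 + 2 * (χ (r ^ 2) * r)) = 0 := by
    have hT : Filter.Tendsto (fun r : ℝ => χ (r ^ 2) * r ^ 2) Filter.atTop (nhds 0) := by
      refine tendsto_const_nhds.congr' ?_
      filter_upwards [Filter.eventually_gt_atTop (2 : ℝ)] with r hr
      rw [χ.zero_of_le_dist, zero_mul]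
      rw [Real.dist_eq, abs_of_pos (by nlinarith)]
      show (1 : ℝ) ≤ _
      nlinarith
    rw [integral_Ioi_of_hasDerivAt_of_tendsto' (fun r _ => hχd r)
      (i2.add (i1.const_mul 2)).integrableOn hT]
    simp
  rw [integral_add i2.integrableOn (i1.const_mul 2).integrableOn, integral_const_mul] at hint
  have hpos : 0 < ∫ r in Set.Ioi (0 : ℝ), χ (r ^ 2) * r := by
    rw [setIntegral_pos_iff_support_of_nonneg_ae _ i1.integrableOn]
    -- For `r` in this interval `|r² - 2| < 1`, so the bump is positive there; the radial factor is
    -- then nonzero and can be cancelled.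
    · refine lt_of_lt_of_le ?_ (measure_mono (s := Set.Ioo (5 / 4 : ℝ) (3 / 2)) ?_)
      · simp; norm_num
      · intro r hr
        have hr0 : 0 < r := by linarith [hr.1]
        refine ⟨mul_ne_zero (χ.pos_of_mem_ball ?_).ne' hr0.ne', hr0⟩
        rw [Metric.mem_ball, Real.dist_eq]
        show _ < (1 : ℝ)
        rw [abs_lt]
        constructor <;> nlinarith [hr.1, hr.2]
    · filter_upwards [ae_restrict_mem measurableSet_Ioi] with r hr
      exact mul_nonneg χ.nonneg (le_of_lt hr)
  rw [e1, e2] at key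
  have : (∫ r in Set.Ioi (0 : ℝ), deriv χ (r ^ 2) * 2 * r ^ 3) =
      -2 * ∫ r in Set.Ioi (0 : ℝ), χ (r ^ 2) * r := by linarith
  rw [this] at key
  have h := mul_left_cancel₀ hpos.ne' (a := ∫ r in Set.Ioi (0 : ℝ), χ (r ^ 2) * r)
    (b := ∫ x, grad f x a ∂area) (c := 2 * ∫ x, coord a x * f x ∂area) (by rw [key]; ring)
  exact h

theorem integral_one_area : ∫ _ : S2, (1 : ℝ) ∂area = 4 * Real.pi := by
  rw [integral_const, smul_eq_mul, mul_one, area, Measure.toSphere_real_apply_univ,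
    Measure.real, EuclideanSpace.volume_ball_fin_three]
  rw [finrank_euclideanSpace_fin, ENNReal.toReal_mul, ENNReal.toReal_pow,
    ENNReal.toReal_ofReal zero_le_one, ENNReal.toReal_ofReal (by positivity)]
  push_cast
  ring

theorem SmoothFn.eq_zero_of_integral_mul_self {f : S2 → ℝ} (hf : SmoothFn f)
    (h : ∫ x, f x * f x ∂area = 0) (x : S2) : f x = 0 := by
  have hc : Continuous fun x => f x * f x := hf.continuous.mul hf.continuous
  have h0 := (integral_eq_zero_iff_of_nonneg (fun x => mul_self_nonneg (f x))
    (hc.integrable_of_hasCompactSupport (HasCompactSupport.of_compactSpace _))).1 h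
  have h1 := (Continuous.ae_eq_iff_eq area hc continuous_zero).1 h0
  simpa using congrFun h1 x

/-! ### The smooth functions on the sphere as an instance of the calculus -/

/-- The algebra of smooth functions on the sphere. -/
abbrev SphereFun : Type := C^∞⟮𝓡 2, S2; 𝓘(ℝ, ℝ), ℝ⟯

namespace SphereFun

theorem smoothFn (f : SphereFun) : SmoothFn f := f.contMDiff

@[simp]
theorem sum_apply {ι : Type*} (s : Finset ι) (f : ι → SphereFun) (x : S2) :
    (∑ i ∈ s, f i) x = ∑ i ∈ s, f i x :=
  map_sum (ContMDiffMap.evalRingHom (I := 𝓡 2) (n := ∞) (R := ℝ) x) f s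

@[simp]
theorem add_apply (f g : SphereFun) (x : S2) : (f + g) x = f x + g x := rfl

@[simp]
theorem sub_apply (f g : SphereFun) (x : S2) : (f - g) x = f x - g x := rfl

@[simp]
theorem neg_apply (f : SphereFun) (x : S2) : (-f) x = - f x := rfl

@[simp]
theorem mul_apply (f g : SphereFun) (x : S2) : (f * g) x = f x * g x := rfl

@[simp]
theorem smul_apply (r : ℝ) (f : SphereFun) (x : S2) : (r • f) x = r * f x := rfl

@[simp]
theorem ite_apply (p : Prop) [Decidable p] (f g : SphereFun) (x : S2) :
    (if p then f else g) x = if p then f x else g x := by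
  split_ifs <;> rfl

theorem integrable (f : SphereFun) : Integrable f area := f.smoothFn.integrable

/-- A component of the tangential gradient as a derivation. -/
def gradDerivation (a : Fin 3) : Derivation ℝ SphereFun SphereFun :=
  Derivation.mk'
    { toFun := fun f => ⟨fun x => grad f x a, f.smoothFn.grad a⟩
      map_add' := fun f g => by
        ext x
        exact grad_add f.smoothFn g.smoothFn x a
      map_smul' := fun r f => by
        ext x
        exact grad_const_smul f.smoothFn r x a }
    (fun f g => by
      ext x
      exact grad_mul f.smoothFn g.smoothFn x a)

/-- The integral over the sphere. -/
def integral : SphereFun →ₗ[ℝ] ℝ where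
  toFun f := ∫ x, f x ∂area
  map_add' f g := integral_add f.integrable g.integrable
  map_smul' r f := integral_const_mul r f

end SphereFun

/-- The tangential calculus of the round sphere. -/
def sphere : TangentialCalculus SphereFun where
  x a := ⟨coord a, smoothFn_coord a⟩
  D := SphereFun.gradDerivation
  int := SphereFun.integral
  sum_x_mul_x := by
    ext x
    have h := EuclideanSpace.norm_sq_eq (x : EuclideanSpace ℝ (Fin 3))
    rw [SphereFun.sum_apply]
    change ∑ a, coord a x * coord a x = 1
    simpa [x.norm_eq, coord, sq] using h.symm
  D_x a b := by
    ext x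
    simp only [SphereFun.sub_apply, SphereFun.ite_apply]
    exact grad_coord b x a
  sum_x_mul_D f := by
    ext x
    rw [SphereFun.sum_apply]
    exact sum_coord_mul_grad f.smoothFn x
  D_comm a b f := by
    ext x
    exact grad_comm f.smoothFn x a b
  int_D a f := integral_grad f.smoothFn a
  int_one := integral_one_area
  int_mul_self_nonneg f := integral_nonneg fun x => mul_self_nonneg (f x)
  eq_zero_of_int_mul_self f h := by
    ext x
    exact f.smoothFn.eq_zero_of_integral_mul_self h x
  eq_const_of_D_eq_zero f h := by
    obtain ⟨r, hr⟩ := exists_eq_const_of_grad_eq_zero f.smoothFn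
      fun x a => congrArg (fun g : SphereFun => g x) (h a)
    exact ⟨r, by ext x; exact hr x⟩

@[simp]
theorem sphere_x_apply (a : Fin 3) (x : S2) : sphere.x a x = coord a x := rfl

@[simp]
theorem sphere_D_apply (a : Fin 3) (f : SphereFun) (x : S2) : sphere.D a f x = grad f x a := rfl

theorem sphere_gradient_apply (a : Fin 3) (f : SphereFun) (x : S2) :
    sphere.gradient f a x = grad f x a := rfl

theorem sphere_int (f : SphereFun) : sphere.int f = ∫ x, f x ∂area := rfl

theorem sphere_met_apply (a b : Fin 3) (x : S2) : sphere.met a b x = metric x a b := by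
  simp [TangentialCalculus.met, metric]

theorem sphere_eps_apply (a b : Fin 3) (x : S2) : sphere.eps a b x = eps x a b := by
  simp only [TangentialCalculus.eps, eps]
  fin_cases a <;> fin_cases b <;> rfl

/-! ### Translation between covariant definitions and the abstract calculus -/

namespace TangentialCalculus

variable {A : Type*} [CommRing A] [Algebra ℝ A] (S : TangentialCalculus A)

theorem sum_met_mul (w : Fin 3 → A) (b : Fin 3) :
    ∑ d, S.met b d * w d = w b - S.x b * ∑ d, S.x d * w d := by
  simp only [met, Fin.sum_univ_three]
  fin_cases b <;> simp <;> ring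

theorem sum_x_mul_D_of_tangent {w : Fin 3 → A} (hw : ∑ a, S.x a * w a = 0) (a : Fin 3) :
    ∑ d, S.x d * S.D a (w d) = - w a := by
  have h := congrArg (S.D a) hw
  simp only [Fin.sum_univ_three, map_add, Derivation.leibniz, smul_eq_mul, S.D_x, map_zero]
    at h hw ⊢
  fin_cases a <;> simp at h ⊢
  · linear_combination h + S.x 0 * hw
  · linear_combination h + S.x 1 * hw
  · linear_combination h + S.x 2 * hw

theorem sum_met_mul_D {w : Fin 3 → A} (hw : ∑ a, S.x a * w a = 0) (a b : Fin 3) :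
    ∑ d, S.met b d * S.D a (w d) = S.D a (w b) + S.x b * w a := by
  rw [S.sum_met_mul (fun d => S.D a (w d)) b, S.sum_x_mul_D_of_tangent hw]
  ring

/-- Projecting the derivative adds only the normal correction `x b * tr T`. Symmetry is not assumed,
because the lemma is also applied to the antisymmetric tensor `curl`. -/
theorem sum_met_mul_met_mul_D {T : Fin 3 → Fin 3 → A} (hT : ∀ a, ∑ b, S.x b * T a b = 0)
    (htr : ∑ a, T a a = 0) (b : Fin 3) :
    ∑ a, ∑ d, ∑ e, S.met a d * S.met b e * S.D a (T d e) = S.dvg T b := by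
  have h1 : ∀ a d, ∑ e, S.met a d * S.met b e * S.D a (T d e) =
      S.met a d * (S.D a (T d b) + S.x b * T d a) := fun a d => by
    rw [← S.sum_met_mul_D (hT d) a b, Finset.mul_sum]
    exact Finset.sum_congr rfl fun e _ => by ring
  have h2 : ∀ a d, S.met a d = S.met d a := fun a d => by
    simp only [met, eq_comm (a := a)]
    ring
  have h3 : ∀ d (g : A), ∑ a, S.met d a * S.D a g = S.D d g := fun d g => by
    rw [S.sum_met_mul (fun a => S.D a g), S.sum_x_mul_D]
    ring
  have h4 : ∀ d, ∑ a, S.met a d * (S.D a (T d b) + S.x b * T d a) =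
      S.D d (T d b) + S.x b * T d d := fun d => by
    have := S.sum_met_mul (fun a => S.x b * T d a) d
    simp only [mul_left_comm _ (S.x b), ← Finset.mul_sum, hT] at this
    simp only [h2 _ d, mul_add, Finset.sum_add_distrib, h3, mul_left_comm _ (S.x b),
      ← Finset.mul_sum, this]
    ring
  simp only [h1]
  rw [Finset.sum_comm]
  simp only [h4, Finset.sum_add_distrib, ← Finset.mul_sum, htr, dvg]
  ring

theorem IsSTT.tangent_right {S : TangentialCalculus A} {T : Fin 3 → Fin 3 → A}
    (hT : IsSTT S T) (a : Fin 3) : ∑ b, S.x b * T a b = 0 := by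
  simpa only [hT.symm a] using hT.tangent a

theorem sum_x_mul_curl_right {t : Fin 3 → A} (ht : ∑ a, S.x a * t a = 0) (b : Fin 3) :
    ∑ a, S.x a * S.curl t b a = 0 := by
  rw [← neg_eq_zero, ← Finset.sum_neg_distrib, ← S.sum_x_mul_curl ht b]
  refine Finset.sum_congr rfl fun a _ => ?_
  simp only [curl]
  ring

theorem trace_curl (t : Fin 3 → A) : ∑ a, S.curl t a a = 0 := by simp [curl]

theorem IsSTT.add {S : TangentialCalculus A} {T U : Fin 3 → Fin 3 → A} (hT : IsSTT S T)
    (hU : IsSTT S U) : IsSTT S (T + U) where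
  symm a b := by rw [Pi.add_apply, Pi.add_apply, hT.symm, hU.symm]; rfl
  tangent b := by
    simp only [Pi.add_apply, mul_add, Finset.sum_add_distrib, hT.tangent, hU.tangent, add_zero]
  traceless := by
    simp only [Pi.add_apply, Finset.sum_add_distrib, hT.traceless, hU.traceless, add_zero]

theorem IsSTT.smul {S : TangentialCalculus A} {T : Fin 3 → Fin 3 → A} (hT : IsSTT S T) (r : ℝ) :
    IsSTT S (fun a b => r • T a b) where
  symm a b := by rw [hT.symm]
  tangent b := by simp only [mul_smul_comm, ← Finset.smul_sum, hT.tangent, smul_zero]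
  traceless := by rw [← Finset.smul_sum, hT.traceless, smul_zero]

end TangentialCalculus

open TangentialCalculus

theorem covDeriv₁_apply {w : Fin 3 → SphereFun} (hw : ∑ a, sphere.x a * w a = 0) (x : S2)
    (a b : Fin 3) :
    covDeriv₁ (fun y d => w d y) x a b = (sphere.D a (w b) + sphere.x b * w a) x := by
  rw [← sphere.sum_met_mul_D hw, covDeriv₁, SphereFun.sum_apply]
  simp [sphere_met_apply]

theorem hess_eq (f : SphereFun) (x : S2) (a b : Fin 3) : hess f x a b = sphere.hess f a b x :=
  covDeriv₁_apply (w := sphere.gradient f) (sphere.sum_x_mul_D f) x a b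

theorem lap_eq (f : SphereFun) (x : S2) : lap f x = sphere.lap f x := by
  rw [← sphere.trace_hess, SphereFun.sum_apply]
  rw [lap, div₁]
  exact Finset.sum_congr rfl fun a _ => hess_eq f x a a

theorem div₂_eq {T : Fin 3 → Fin 3 → SphereFun} (hT : ∀ a, ∑ b, sphere.x b * T a b = 0)
    (htr : ∑ a, T a a = 0) : div₂ (fun y a b => T a b y) = fun x b => sphere.dvg T b x := by
  ext x b
  rw [← sphere.sum_met_mul_met_mul_D hT htr, div₂]
  simp only [covDeriv₂, SphereFun.sum_apply, SphereFun.mul_apply, sphere_met_apply,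
    sphere_D_apply]

theorem curlDiv_eq {C : Fin 3 → Fin 3 → SphereFun} (hC : IsSTT sphere C) :
    curlDiv (fun y a b => C a b y) = fun x b a => sphere.curl (sphere.dvg C) b a x := by
  ext x b a
  rw [curlDiv, div₂_eq hC.tangent_right hC.traceless, covDeriv₁_apply hC.sum_x_mul_dvg,
    covDeriv₁_apply hC.sum_x_mul_dvg]
  rfl

theorem div₂_curlDiv_eq {C : Fin 3 → Fin 3 → SphereFun} (hC : IsSTT sphere C) :
    div₂ (curlDiv (fun y a b => C a b y)) =
      fun x a => sphere.dvg (sphere.curl (sphere.dvg C)) a x := by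
  rw [curlDiv_eq hC, div₂_eq (sphere.sum_x_mul_curl_right hC.sum_x_mul_dvg) (sphere.trace_curl _)]

theorem coclosedPart_eq (cb : SphereFun) :
    coclosedPart cb = fun x a b => ((1 / 2 : ℝ) • sphere.rotHess cb a b) x := by
  ext x a b
  simp [coclosedPart, rotHess, hess_eq, sphere_eps_apply]

theorem rot_eq_apply (k a : Fin 3) (x : S2) : rot k x a = sphere.rot k a x := by
  simp only [rot, TangentialCalculus.rot, SphereFun.sum_apply, SphereFun.mul_apply,
    sphere_eps_apply, sphere_D_apply]
  rfl

theorem lowModes_eq (f : SphereFun) (x : S2) : lowModes f x = sphere.lowModes f x := by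
  simp [lowModes, TangentialCalculus.lowModes, sphere_int]

theorem inner₂_self_eq (C : Fin 3 → Fin 3 → SphereFun) :
    inner₂ (fun y a b => C a b y) (fun y a b => C a b y) = normSq C := by
  ext x
  simp [inner₂, normSq]

theorem Fields.angularMomentum_eq {D : Fields} {u : ℝ} {m : SphereFun} {N : Fin 3 → SphereFun}
    {C : Fin 3 → Fin 3 → SphereFun} (hC : IsSTT sphere C) (hm : D.m u = m)
    (hN : D.N u = fun x a => N a x) (hDC : D.C u = fun x a b => C a b x) (c : SphereFun)
    (k : Fin 3) : D.angularMomentum u c k = sphere.angularMomentum m N C c k := by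
  have e : sphere.angularMomentum m N C c k =
      sphere.pair (sphere.rot k) (N - (1 / 4 : ℝ) • sphere.quad C - fun a => c * sphere.D a m) := by
    simp only [TangentialCalculus.angularMomentum, map_sub, map_smul, smul_eq_mul]
  rw [e, pair_apply, sphere_int, Fields.angularMomentum, hm, hN, hDC,
    div₂_eq hC.tangent_right hC.traceless]
  simp [rot_eq_apply, quad]

theorem Fields.centerOfMass_eq {D : Fields} {u : ℝ} {m : SphereFun} {N : Fin 3 → SphereFun}
    {C : Fin 3 → Fin 3 → SphereFun} (hC : IsSTT sphere C) (hm : D.m u = m)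
    (hN : D.N u = fun x a => N a x) (hDC : D.C u = fun x a b => C a b x) (c cb : SphereFun)
    (k : Fin 3) : D.centerOfMass u c cb k = sphere.centerOfMass u m N C c cb k := by
  set F : Fin 3 → Fin 3 → SphereFun := fun a b => (1 / 2 : ℝ) • sphere.rotHess cb a b with hF
  have e : sphere.centerOfMass u m N C c cb k =
      sphere.pair (sphere.gradient (sphere.x k)) (N - u • sphere.gradient m
        - (1 / 4 : ℝ) • sphere.quad C - (1 / 16 : ℝ) • sphere.gradient (normSq C)
        - (fun a => c * sphere.D a m)
        + (2 : ℝ) • fun a => (∑ b, sphere.eps a b * sphere.D b cb) * m)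
      + sphere.int ((3 : ℝ) • (sphere.x k * c * m)
        - (1 / 4 : ℝ) • (sphere.x k * ∑ b, sphere.dvg F b * sphere.dvg F b)) := by
    simp only [TangentialCalculus.centerOfMass, map_sub, map_add, map_smul, smul_eq_mul, hF]
    ring
  have hFs : IsSTT sphere F := (sphere.isSTT_rotHess cb).smul _
  rw [e, pair_apply, sphere_int, sphere_int, Fields.centerOfMass, hm, hN, hDC,
    div₂_eq hC.tangent_right hC.traceless, coclosedPart_eq, inner₂_self_eq,
    div₂_eq hFs.tangent_right hFs.traceless]
  congr 1
  · refine integral_congr_ae (Filter.Eventually.of_forall fun x => ?_)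
    simp only [SphereFun.sum_apply, SphereFun.mul_apply, Pi.sub_apply, Pi.add_apply, Pi.smul_apply,
      SphereFun.sub_apply, SphereFun.add_apply, SphereFun.smul_apply, quad, sphere_eps_apply,
      sphere_gradient_apply, sphere_D_apply]
    refine Finset.sum_congr rfl fun a _ => ?_
    change grad (coord k) x a * _ = grad (coord k) x a * _
    ring
  · refine integral_congr_ae (Filter.Eventually.of_forall fun x => ?_)
    simp
    ring

/-! ### Evolution of the fields when the news vanishes -/

theorem grad_zero : grad (0 : S2 → ℝ) = 0 := by
  have h : radialExt (0 : S2 → ℝ) = 0 := by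
    ext y
    simp [radialExt]
  ext x a
  simp [grad, h]

theorem div₂_zero : div₂ (0 : S2 → Fin 3 → Fin 3 → ℝ) = 0 := by
  ext x b
  have h : (fun _ : S2 => (0 : ℝ)) = 0 := rfl
  simp [div₂, covDeriv₂, h, grad_zero]

theorem div₁_zero : div₁ (0 : S2 → Fin 3 → ℝ) = 0 := by
  ext x
  have h : (fun _ : S2 => (0 : ℝ)) = 0 := rfl
  simp [div₁, covDeriv₁, h, grad_zero]

theorem SmoothOn.slice {I : Set ℝ} {F : ℝ → S2 → ℝ} (hF : SmoothOn I F) {u : ℝ} (hu : u ∈ I) :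
    SmoothFn (F u) := by
  have h : ContMDiff (𝓡 2) (𝓘(ℝ, ℝ).prod (𝓡 2)) ∞ (fun x : S2 => (u, x)) :=
    contMDiff_const.prodMk contMDiff_id
  rw [SmoothFn, ← contMDiffOn_univ]
  exact hF.comp h.contMDiffOn fun x _ => ⟨hu, Set.mem_univ _⟩

theorem SmoothOn.differentiableOn {I : Set ℝ} {F : ℝ → S2 → ℝ} (hF : SmoothOn I F) (x : S2) :
    DifferentiableOn ℝ (fun u => F u x) I := by
  have h : ContMDiff 𝓘(ℝ, ℝ) (𝓘(ℝ, ℝ).prod (𝓡 2)) ∞ (fun u : ℝ => (u, x)) :=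
    contMDiff_id.prodMk contMDiff_const
  have h2 := hF.comp h.contMDiffOn (s := I) fun u hu => ⟨hu, Set.mem_univ _⟩
  exact (contMDiffOn_iff_contDiffOn.1 h2).differentiableOn (by simp)

theorem eq_add_mul_of_derivWithin_eq {I : Set ℝ} (hI : I.OrdConnected) {g : ℝ → ℝ}
    (hg : DifferentiableOn ℝ g I) {r : ℝ} (h : ∀ u ∈ I, derivWithin g I u = r) {u v : ℝ}
    (hu : u ∈ I) (hv : v ∈ I) : g v = g u + (v - u) * r := by
  have hd : ∀ w ∈ I, HasDerivWithinAt (fun w => g w - w * r) 0 I w := by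
    intro w hw
    have h1 := (hg w hw).hasDerivWithinAt
    rw [h w hw] at h1
    have h2 : HasDerivWithinAt (fun w => w * r) r I w := by
      simpa using (hasDerivWithinAt_id w I).mul_const r
    rw [← sub_self r]
    exact h1.sub h2
  have := hI.convex.norm_image_sub_le_of_norm_hasDerivWithin_le (C := 0) hd (by simp) hu hv
  simp only [zero_mul, norm_le_zero_iff] at this
  linear_combination this

theorem Fields.VanishingNews.news_eq_zero {D : Fields} {I : Set ℝ} (h : D.VanishingNews I)
    {u : ℝ} (hu : u ∈ I) : D.news I u = 0 := by
  ext x a b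
  exact h u hu x a b

namespace Fields.IsNullInfinityData

variable {D : Fields} {I : Set ℝ} (hD : D.IsNullInfinityData I)
  {u : ℝ} (hu : u ∈ I)

/-- The mass aspect at a fixed retarded time, as a smooth function. -/
def massFun : SphereFun := ⟨D.m u, hD.smooth_m.slice hu⟩

/-- The angular momentum aspect at a fixed retarded time. -/
def aspectFun (a : Fin 3) : SphereFun := ⟨fun x => D.N u x a, (hD.smooth_N a).slice hu⟩

/-- The shear at a fixed retarded time. -/
def shearFun (a b : Fin 3) : SphereFun := ⟨fun x => D.C u x a b, (hD.smooth_C a b).slice hu⟩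

theorem isSTT_shearFun : IsSTT sphere (hD.shearFun hu) where
  symm a b := by
    ext x
    exact hD.symm_C u hu x a b
  tangent b := by
    ext x
    rw [SphereFun.sum_apply]
    exact hD.tangent_C u hu x b
  traceless := by
    ext x
    rw [SphereFun.sum_apply]
    exact hD.traceless_C u hu x

end Fields.IsNullInfinityData

theorem Fields.IsNullInfinityData.m_eq {D : Fields} {I : Set ℝ} (hI : I.OrdConnected)
    (hD : D.IsNullInfinityData I) (hnews : D.VanishingNews I) {u v : ℝ} (hu : u ∈ I)
    (hv : v ∈ I) : D.m v = D.m u := by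
  ext x
  have := eq_add_mul_of_derivWithin_eq hI (hD.smooth_m.differentiableOn x) (r := 0)
    (fun w hw => by
      rw [hD.evolution_m w hw x, hnews.news_eq_zero hw, div₂_zero, div₁_zero]
      simp [inner₂]) hu hv
  simpa using this

theorem Fields.IsNullInfinityData.C_eq {D : Fields} {I : Set ℝ} (hI : I.OrdConnected)
    (hD : D.IsNullInfinityData I) (hnews : D.VanishingNews I) {u v : ℝ} (hu : u ∈ I)
    (hv : v ∈ I) : D.C v = D.C u := by
  ext x a b
  have := eq_add_mul_of_derivWithin_eq hI ((hD.smooth_C a b).differentiableOn x) (r := 0)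
    (fun w hw => hnews w hw x a b) hu hv
  simpa using this

/-- With `m` and `C` constant in `u`, the right side of the evolution equation for `N` is constant
too, so `N` is affine. -/
theorem Fields.IsNullInfinityData.N_eq {D : Fields} {I : Set ℝ} (hI : I.OrdConnected)
    (hD : D.IsNullInfinityData I) (hnews : D.VanishingNews I) {u v : ℝ} (hu : u ∈ I)
    (hv : v ∈ I) (x : S2) (a : Fin 3) :
    D.N v x a = D.N u x a +
      (v - u) * (grad (D.m u) x a - (1 / 4) * div₂ (curlDiv (D.C u)) x a) := by
  refine eq_add_mul_of_derivWithin_eq hI ((hD.smooth_N a).differentiableOn x)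
    (fun w hw => ?_) hu hv
  have h1 : inner₂ (D.C w) 0 = 0 := by
    ext y
    simp [inner₂]
  have h2 : (fun (y : S2) (b e : Fin 3) => ∑ d, D.C w y b d * (0 : S2 → Fin 3 → Fin 3 → ℝ) y d e)
      = 0 := by
    ext y b e
    simp
  rw [hD.evolution_N w hw x a, hnews.news_eq_zero hw, h1, h2, div₂_zero, grad_zero,
    hD.m_eq hI hnews hu hw, hD.C_eq hI hnews hu hw]
  simp

/-! ### Comparison of the charges and assembly of the theorem -/

theorem hessTF_apply (f : SphereFun) (a b : Fin 3) (x : S2) :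
    sphere.hessTF f a b x = 2 * hess f x a b - metric x a b * lap f x := by
  rw [hessTF, two_mul, hess_eq, lap_eq, ← sphere_met_apply]
  simp only [SphereFun.add_apply, SphereFun.sub_apply, SphereFun.mul_apply]
  ring

theorem aspectShift_apply (m f : SphereFun) (C : Fin 3 → Fin 3 → SphereFun) (s : ℝ) (a : Fin 3)
    (x : S2) : sphere.aspectShift m C s f a x =
      s * grad m x a + (f x * grad m x a + 3 * m x * grad f x a)
        - 1 / 4 * (s * sphere.dvg (sphere.curl (sphere.dvg C)) a x
          + (f x * sphere.dvg (sphere.curl (sphere.dvg C)) a x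
            + 3 * ∑ b, sphere.curl (sphere.dvg C) b a x * grad f x b)) := by
  have three : ∀ g : SphereFun, 3 * g = g + g + g := fun g => by ring
  simp only [aspectShift, Pi.add_apply, Pi.sub_apply, Pi.smul_apply, three, SphereFun.add_apply,
    SphereFun.sub_apply, SphereFun.smul_apply, SphereFun.mul_apply, SphereFun.sum_apply,
    sphere_gradient_apply, sphere_D_apply]
  ring

theorem IsPotentials.two_mul_eq {C : Fin 3 → Fin 3 → SphereFun} {c cb : SphereFun}
    (h : IsPotentials (fun x a b => C a b x) c cb) (a b : Fin 3) :
    2 * C a b = sphere.hessTF c a b + sphere.rotHess cb a b := by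
  ext x
  have := h.decomposition x a b
  simp only [coclosedPart_eq, SphereFun.smul_apply] at this
  rw [two_mul, SphereFun.add_apply, SphereFun.add_apply, hessTF_apply]
  linear_combination 2 * this

/-- Serves both halves of the theorem: `D'` is `D` itself at another time with `f = 0`, or the
supertranslated fields. -/
theorem charges_shift {D D' : Fields} {u u' : ℝ} {m f c cb c' cb' : SphereFun}
    {N : Fin 3 → SphereFun} {C : Fin 3 → Fin 3 → SphereFun} (hC : IsSTT sphere C)
    (hm : D.m u = m) (hN : D.N u = fun x a => N a x) (hDC : D.C u = fun x a b => C a b x)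
    (hm' : D'.m u' = m)
    (hN' : D'.N u' = fun x a => (N + sphere.aspectShift m C (u' - u) f) a x)
    (hDC' : D'.C u' = fun x a b => (C + sphere.shearShift f) a b x)
    (hc : IsPotentials (D.C u) c cb) (hc' : IsPotentials (D'.C u') c' cb') (k : Fin 3) :
    D'.angularMomentum u' c' k - D.angularMomentum u c k =
        -2 * ∫ x, ∑ a, rot k x a * lowModes f x * grad m x a ∂area ∧
    D'.centerOfMass u' c' cb' k - D.centerOfMass u c cb k =
        ∫ x, (6 * lowModes f x * coord k x * m x - 2 * lowModes f x *
          ∑ a, grad (coord k) x a * grad m x a) ∂area := by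
  rw [hDC] at hc
  rw [hDC'] at hc'
  have hCf : IsSTT sphere (C + sphere.shearShift f) := hC.add (sphere.isSTT_shearShift f)
  obtain ⟨rfl, rfl⟩ := sphere.potentials_shift (c := c) (cb := cb) (c' := c') (cb' := cb') (f := f)
    (fun a b => by
      rw [← hc.two_mul_eq, ← hc'.two_mul_eq, Pi.add_apply, Pi.add_apply, mul_add])
    hc.high_c.1 hc.high_c.2 hc.high_cb.1 hc.high_cb.2
    hc'.high_c.1 hc'.high_c.2 hc'.high_cb.1 hc'.high_cb.2
  rw [Fields.angularMomentum_eq hC hm hN hDC, Fields.angularMomentum_eq hCf hm' hN' hDC',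
    Fields.centerOfMass_eq hC hm hN hDC, Fields.centerOfMass_eq hCf hm' hN' hDC',
    sphere.angularMomentum_shift hC, sphere.centerOfMass_shift hC]
  refine ⟨?_, ?_⟩
  · rw [pair_apply, sphere_int]
    simp only [SphereFun.sum_apply, SphereFun.mul_apply, rot_eq_apply, lowModes_eq,
      sphere_D_apply, mul_assoc]
  · rw [pair_apply, ← smul_eq_mul, ← smul_eq_mul (2 : ℝ), ← map_smul, ← map_smul, ← map_sub,
      sphere_int]
    refine integral_congr_ae (Filter.Eventually.of_forall fun x => ?_)
    simp only [SphereFun.sum_apply, SphereFun.mul_apply, SphereFun.sub_apply,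
      SphereFun.smul_apply, lowModes_eq, sphere_D_apply, sphere_x_apply, sphere_gradient_apply,
      Finset.mul_sum]
    congr 1
    · ring
    · refine Finset.sum_congr rfl fun a _ => ?_
      change 2 * (grad (coord k) x a * _) = _
      ring

/-- The time `ub + f x` differs from `u` by the constant `ub - u` plus `f x`. The affine dependence
of `N` on time splits accordingly, and the `f` part joins the terms `3m∇f - ¾P∇f` of the
transformation law. -/
theorem Fields.supertranslate_eq {D : Fields} {I : Set ℝ} (hI : I.OrdConnected)
    (hD : D.IsNullInfinityData I) (hnews : D.VanishingNews I) {u : ℝ} (hu : u ∈ I)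
    (f : SphereFun) {ub : ℝ} (hub : ∀ x, ub + f x ∈ I) :
    (D.supertranslate I f).m ub = hD.massFun hu ∧
    (D.supertranslate I f).N ub = (fun x a => (hD.aspectFun hu +
      sphere.aspectShift (hD.massFun hu) (hD.shearFun hu) (ub - u) f) a x) ∧
    (D.supertranslate I f).C ub =
      (fun x a b => (hD.shearFun hu + sphere.shearShift f) a b x) := by
  have hC : D.C u = fun x a b => hD.shearFun hu a b x := rfl
  have hST := hD.isSTT_shearFun hu
  refine ⟨?_, ?_, ?_⟩
  · ext x
    have hd : ∀ b d, derivWithin (fun s => D.news I s x b d) I (ub + f x) = 0 := by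
      intro b d
      rw [derivWithin_congr (f := fun _ => (0 : ℝ)) (fun w hw => hnews w hw x b d)
        (hnews _ (hub x) x b d)]
      simp
    simp only [supertranslate, hnews.news_eq_zero (hub x), div₂_zero, hd,
      hD.m_eq hI hnews hu (hub x)]
    simp [inner₂]
    rfl
  · ext x a
    simp only [supertranslate, hD.m_eq hI hnews hu (hub x), hD.C_eq hI hnews hu (hub x),
      hD.N_eq hI hnews hu (hub x)]
    rw [hC, div₂_curlDiv_eq hST, curlDiv_eq hST]
    rw [Pi.add_apply, SphereFun.add_apply, aspectShift_apply]
    change D.N u x a + _ * (grad (D.m u) x a - _) + 3 * D.m u x * _ - _ = D.N u x a +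
      (_ * grad (D.m u) x a + (_ * grad (D.m u) x a + 3 * D.m u x * _) - _)
    ring
  · ext x a b
    simp only [supertranslate, hD.C_eq hI hnews hu (hub x)]
    simp only [Pi.add_apply, SphereFun.add_apply, shearShift, SphereFun.neg_apply, hessTF_apply]
    change D.C u x a b - _ + _ = D.C u x a b + _
    ring

theorem Fields.IsNullInfinityData.charges_eq {D : Fields} {I : Set ℝ} (hI : I.OrdConnected)
    (hD : D.IsNullInfinityData I) (hnews : D.VanishingNews I) {u v : ℝ} (hu : u ∈ I)
    (hv : v ∈ I) {c cb c' cb' : S2 → ℝ} (hc : IsPotentials (D.C u) c cb)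
    (hc' : IsPotentials (D.C v) c' cb') (k : Fin 3) :
    D.angularMomentum v c' k = D.angularMomentum u c k ∧
    D.centerOfMass v c' cb' k = D.centerOfMass u c cb k := by
  have hN : D.N v = fun x a => (hD.aspectFun hu +
      sphere.aspectShift (hD.massFun hu) (hD.shearFun hu) (v - u) 0) a x := by
    ext x a
    rw [hD.N_eq hI hnews hu hv, Pi.add_apply, SphereFun.add_apply, aspectShift_apply,
      show D.C u = fun x a b => hD.shearFun hu a b x from rfl,
      div₂_curlDiv_eq (hD.isSTT_shearFun hu)]
    change D.N u x a + _ * (grad (D.m u) x a - _) = D.N u x a + (_ * grad (D.m u) x a +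
      (0 * _ + 3 * _ * grad (0 : S2 → ℝ) x a) - 1 / 4 * (_ + (0 * _ + 3 * ∑ b, _ *
        grad (0 : S2 → ℝ) x b)))
    simp only [grad_zero, Pi.zero_apply, mul_zero, Finset.sum_const_zero]
    ring
  have hl : ∀ x, lowModes (0 : SphereFun) x = 0 := fun x => by simp [lowModes]
  -- Evolution from `u` to `v` is treated as the shift with `f = 0`, whose low modes vanish, so both
  -- right sides are zero.
  have h := charges_shift (D := D) (D' := D) (u := u) (u' := v) (m := hD.massFun hu) (f := 0)
    (c := ⟨c, hc.smooth_c⟩) (cb := ⟨cb, hc.smooth_cb⟩) (c' := ⟨c', hc'.smooth_c⟩)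
    (cb' := ⟨cb', hc'.smooth_cb⟩) (N := hD.aspectFun hu) (hD.isSTT_shearFun hu) rfl rfl rfl
    (hD.m_eq hI hnews hu hv) hN
    (by
      ext x a b
      have : sphere.shearShift 0 a b = 0 := by
        simp [TangentialCalculus.shearShift, TangentialCalculus.hessTF,
          TangentialCalculus.hess, TangentialCalculus.lap]
      rw [hD.C_eq hI hnews hu hv, Pi.add_apply, Pi.add_apply, this, add_zero]
      rfl) hc hc' k
  simp only [hl, mul_zero, zero_mul, Finset.sum_const_zero, sub_zero, integral_zero] at h
  exact ⟨sub_eq_zero.1 h.1, sub_eq_zero.1 h.2⟩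

end NullInfinity

end

theorem mainTheorem7 (I : Set ℝ) (hI : I.OrdConnected)
    (D : NullInfinity.Fields) (hD : D.IsNullInfinityData I) (hnews : D.VanishingNews I)
    (c cb : ℝ → NullInfinity.S2 → ℝ)
    (hc : ∀ u ∈ I, NullInfinity.IsPotentials (D.C u) (c u) (cb u)) :
    (∀ k : Fin 3, ∀ u ∈ I, ∀ u' ∈ I,
      D.angularMomentum u (c u) k = D.angularMomentum u' (c u') k ∧
      D.centerOfMass u (c u) (cb u) k = D.centerOfMass u' (c u') (cb u') k) ∧
    ∀ f : NullInfinity.S2 → ℝ, NullInfinity.SmoothFn f →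
      ∀ ub₀ : ℝ, (∀ x, ub₀ + f x ∈ I) →
      ∀ cbar cbbar : NullInfinity.S2 → ℝ,
      NullInfinity.IsPotentials ((D.supertranslate I f).C ub₀) cbar cbbar →
      ∀ u₀ ∈ I, ∀ k : Fin 3,
        (D.supertranslate I f).angularMomentum ub₀ cbar k - D.angularMomentum u₀ (c u₀) k =
          -2 * ∫ x, ∑ a, NullInfinity.rot k x a * NullInfinity.lowModes f x *
            NullInfinity.grad (D.m u₀) x a ∂NullInfinity.area ∧
        (D.supertranslate I f).centerOfMass ub₀ cbar cbbar k
            - D.centerOfMass u₀ (c u₀) (cb u₀) k =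
          ∫ x, (6 * NullInfinity.lowModes f x * NullInfinity.coord k x * D.m u₀ x
            - 2 * NullInfinity.lowModes f x *
              ∑ a, NullInfinity.grad (NullInfinity.coord k) x a *
                NullInfinity.grad (D.m u₀) x a) ∂NullInfinity.area := by

  refine ⟨fun k u hu u' hu' => hD.charges_eq hI hnews hu' hu (hc u' hu') (hc u hu) k, ?_⟩
  intro f hf ub₀ hub cbar cbbar hcbar u₀ hu₀ k
  obtain ⟨hm, hN, hC⟩ := NullInfinity.Fields.supertranslate_eq hI hD hnews hu₀ ⟨f, hf⟩ hub
  exact NullInfinity.charges_shift (c := ⟨c u₀, (hc u₀ hu₀).smooth_c⟩)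
    (cb := ⟨cb u₀, (hc u₀ hu₀).smooth_cb⟩) (c' := ⟨cbar, hcbar.smooth_c⟩)
    (cb' := ⟨cbbar, hcbar.smooth_cb⟩) (hD.isSTT_shearFun hu₀) rfl rfl rfl hm hN hC
    (hc u₀ hu₀) hcbar k
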